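/- Let $A$ be a fixed integer $(r,s)\times t$ bimatrix, that is, a pair of integer matrices $A_1\in\mathbb{Z}^{r\times t}$, $A_2\in\mathbb{Z}^{s\times t}$. For each $n$ let $A^{(n)}$ be its $n$-fold product, the $(r+ns)\times nt$ matrix whose first $r$ rows are $(A_1\ A_1\ \cdots\ A_1)$ and whose remaining rows form the block diagonal matrix with $n$ blocks $A_2$. For $b\in\mathbb{Z}^{r+ns}$ and $l,u\in\mathbb{Z}^{nt}$ call $x\in\mathbb{Z}^{nt}$ feasible if $A^{(n)}x=b$ and $l\le x\le u$, and consider the program of minimizing $f(x)$ over the feasible points, where $f:\mathbb{R}^{nt}\to\mathbb{R}$ is separable convex, i.e. $f(x)=\sum_{i=1}^{n}\sum_{j=1}^{t}f^i_j(x^i_j)$ with all $f^i_j:\mathbb{R}\to\mathbb{R}$ convex. A feasible step for a feasible point $x$ is a vector $g\in\mathbb{Z}^{nt}$ such that $x+g$ is feasible; it is augmenting if moreover $f(x+g)<f(x)$. The Graver basis $\mathcal{G}(A^{(n)})$ is the set of $\sqsubseteq$-minimal elements of $\{v\in\mathbb{Z}^{nt}: A^{(n)}v=0,\ v\ne 0\}$,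 where $v\sqsubseteq w$ means that $v_kw_k\ge 0$ and $|v_k|\le|w_k|$ for all $k$. The function $f$ is accessible only through a comparison oracle which, queried on two vectors $v,w$, tells whether $f(v)\le f(w)$. Theorem. For every fixed bimatrix $A$ there are a single algorithm and a constant $C$ (both depending only on $A$) such that for all $n$, $b$, $l$, $u$, every separable convex $f$ given by a comparison oracle, and every feasible point $x$, the algorithm, given $n,b,l,u,x$ and the oracle, halts and either (a) asserts that $x$ is optimal, in which case $f(x)\le f(y)$ for every feasible $y$; or (b) outputs an augmenting step $g$ for $x$ which satisfies $f(x+g)\le f(x+\bar g)$ for every feasible step $\bar g\in\mathcal{G}(A^{(n)})$ for $x$. The running time is linear: the algorithm performs at most $C(n+1)$ arithmetic operations and oracle queries. Here an algorithm is a finite program with while-loops for a machine with finitely many integer registers and integer arrays, whose arithmetic operations are additions, subtractions and comparisons, which can read and write single array entries and copy arrays, and which can query the oracle on the vectors stored in two arrays; moreover, the bound $C(n+1)$ holds for the number of all executed instructions, each data movement (including the copying of an array) being counted as one instruction. -/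

import Mathlib

namespace NFold

/-! ### Integer programs, Graver bases and `n`-fold products -/

/-- The partial order `⊑`: `x ⊑ y` iff `x i * y i ≥ 0` and `|x i| ≤ |y i|` for all `i`. -/
def ConformalLE {ι : Type*} (x y : ι → ℤ) : Prop :=
  ∀ i, 0 ≤ x i * y i ∧ |x i| ≤ |y i|

/-- The Graver basis of `M`: the `⊑`-minimal nonzero integer vectors in the kernel of `M`. -/
def graverBasis {κ ι : Type*} [Fintype ι] (M : Matrix κ ι ℤ) : Set (ι → ℤ) :=
  {g | (M.mulVec g = 0 ∧ g ≠ 0) ∧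
    ∀ h : ι → ℤ, M.mulVec h = 0 → h ≠ 0 → ConformalLE h g → h = g}

/-- The `n`-fold product of the bimatrix with blocks `A₁` and `A₂`: one row of `n` copies of
`A₁`, and below it the block diagonal matrix with `n` copies of `A₂`.
The column `(i, j)` is the `j`-th coordinate of the `i`-th brick. -/
def nFoldProduct {r s t : ℕ} (n : ℕ) (A₁ : Matrix (Fin r) (Fin t) ℤ)
    (A₂ : Matrix (Fin s) (Fin t) ℤ) : Matrix (Fin r ⊕ Fin n × Fin s) (Fin n × Fin t) ℤ :=
  fun row col =>
    match row with
    | Sum.inl k => A₁ k col.2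
    | Sum.inr (i, k) => if i = col.1 then A₂ k col.2 else 0

/-- The feasible set `{x integer : M x = b, l ≤ x ≤ u}`. -/
def feasibleSet {κ ι : Type*} [Fintype ι] (M : Matrix κ ι ℤ) (b : κ → ℤ) (l u : ι → ℤ) :
    Set (ι → ℤ) :=
  {x | M.mulVec x = b ∧ l ≤ x ∧ x ≤ u}

/-- `f` is a sum of univariate convex functions of the single coordinates. -/
def SeparableConvex {ι : Type*} [Fintype ι] (f : (ι → ℝ) → ℝ) : Prop :=
  ∃ φ : ι → ℝ → ℝ, (∀ i, ConvexOn ℝ Set.univ (φ i)) ∧ ∀ x, f x = ∑ i, φ i (x i)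

/-- An integer vector, regarded as a real vector. -/
def toReal {ι : Type*} (x : ι → ℤ) : ι → ℝ := fun i => (x i : ℝ)

/-! ### Programs with a comparison oracle -/

/-- Programs of an integer random access machine with scalar registers and arrays (both named by
natural numbers) and a comparison oracle. A program is a finite object, so that it mentions
only finitely many registers, arrays and integer constants. -/
inductive Prog : Type
  /-- the empty program -/
  | skip : Prog
  /-- `r_d := c` -/
  | const (d : ℕ) (c : ℤ) : Prog
  /-- `r_d := r_p + r_q` -/
  | add (d p q : ℕ) : Prog
  /-- `r_d := r_p - r_q` -/
  | sub (d p q : ℕ) : Prog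
  /-- `r_d := v[r_i]` -/
  | load (d v i : ℕ) : Prog
  /-- `v[r_i] := r_p` -/
  | store (v i p : ℕ) : Prog
  /-- `v := w` for arrays `v`, `w` (movement of data only) -/
  | copy (v w : ℕ) : Prog
  /-- first `P`, then `Q` -/
  | seq (P Q : Prog) : Prog
  /-- if `r_p ≤ r_q` then `P` else `Q` -/
  | ite (p q : ℕ) (P Q : Prog) : Prog
  /-- query the oracle on the arrays `v`, `w`; on the answer "yes" do `P`, otherwise `Q` -/
  | query (v w : ℕ) (P Q : Prog) : Prog
  /-- while `r_p ≤ r_q` do `P` -/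
  | loop (p q : ℕ) (P : Prog) : Prog

/-- A memory state: the contents of the scalar registers and of the arrays. -/
structure State where
  /-- `reg k` is the content of the register `k` -/
  reg : ℕ → ℤ
  /-- `arr v k` is the `k`-th entry of the array `v` -/
  arr : ℕ → ℕ → ℤ

/-- The state after `r_d := z`. -/
def State.setReg (σ : State) (d : ℕ) (z : ℤ) : State :=
  { σ with reg := Function.update σ.reg d z }

/-- The state after the array `v` has been replaced by `a`. -/
def State.setArr (σ : State) (v : ℕ) (a : ℕ → ℤ) : State :=
  { σ with arr := Function.update σ.arr v a }

/-- `Exec O P σ σ' c`: with oracle `O`, the program `P`, started in the state `σ`, halts in the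
state `σ'` after exactly `c` steps. Every executed instruction is one step: every arithmetic
operation, every comparison (of a branching or of a loop test, the last one included), every
oracle query, and also every movement of data. Multiplications and divisions are not
available. -/
inductive Exec (O : (ℕ → ℤ) → (ℕ → ℤ) → Prop) : Prog → State → State → ℕ → Prop
  | skip (σ : State) : Exec O Prog.skip σ σ 0
  | const (σ : State) (d : ℕ) (c : ℤ) : Exec O (Prog.const d c) σ (σ.setReg d c) 1
  | add (σ : State) (d p q : ℕ) :
      Exec O (Prog.add d p q) σ (σ.setReg d (σ.reg p + σ.reg q)) 1
  | sub (σ : State) (d p q : ℕ) :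
      Exec O (Prog.sub d p q) σ (σ.setReg d (σ.reg p - σ.reg q)) 1
  | load (σ : State) (d v i : ℕ) :
      Exec O (Prog.load d v i) σ (σ.setReg d (σ.arr v (σ.reg i).toNat)) 1
  | store (σ : State) (v i p : ℕ) :
      Exec O (Prog.store v i p) σ
        (σ.setArr v (Function.update (σ.arr v) (σ.reg i).toNat (σ.reg p))) 1
  | copy (σ : State) (v w : ℕ) : Exec O (Prog.copy v w) σ (σ.setArr v (σ.arr w)) 1
  | seq {P Q : Prog} {σ σ' σ'' : State} {c c' : ℕ} :
      Exec O P σ σ' c → Exec O Q σ' σ'' c' → Exec O (Prog.seq P Q) σ σ'' (c + c')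
  | ite_true {p q : ℕ} {P Q : Prog} {σ σ' : State} {c : ℕ} :
      σ.reg p ≤ σ.reg q → Exec O P σ σ' c → Exec O (Prog.ite p q P Q) σ σ' (c + 1)
  | ite_false {p q : ℕ} {P Q : Prog} {σ σ' : State} {c : ℕ} :
      ¬ σ.reg p ≤ σ.reg q → Exec O Q σ σ' c → Exec O (Prog.ite p q P Q) σ σ' (c + 1)
  | query_true {v w : ℕ} {P Q : Prog} {σ σ' : State} {c : ℕ} :
      O (σ.arr v) (σ.arr w) → Exec O P σ σ' c → Exec O (Prog.query v w P Q) σ σ' (c + 1)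
  | query_false {v w : ℕ} {P Q : Prog} {σ σ' : State} {c : ℕ} :
      ¬ O (σ.arr v) (σ.arr w) → Exec O Q σ σ' c → Exec O (Prog.query v w P Q) σ σ' (c + 1)
  | loop_done {p q : ℕ} {P : Prog} {σ : State} :
      ¬ σ.reg p ≤ σ.reg q → Exec O (Prog.loop p q P) σ σ 1
  | loop_step {p q : ℕ} {P : Prog} {σ σ' σ'' : State} {c c' : ℕ} :
      σ.reg p ≤ σ.reg q → Exec O P σ σ' c → Exec O (Prog.loop p q P) σ' σ'' c' →
        Exec O (Prog.loop p q P) σ σ'' (c + c' + 1)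

/-! ### Input, output and oracle for `n`-fold programs -/

/-- The array that lists the entries of `x` in the order given by `e`, followed by zeros. -/
def listArray {ι : Type*} {N : ℕ} (e : ι ≃ Fin N) (x : ι → ℤ) : ℕ → ℤ :=
  fun k => if h : k < N then x (e.symm ⟨k, h⟩) else 0

/-- The vector of `n` bricks of size `t` stored brick after brick in the array `a`. -/
def readBricks (n t : ℕ) (a : ℕ → ℤ) : Fin n × Fin t → ℤ :=
  fun p => a (p.1 * t + p.2)

/-- The initial state: `n` is in the register `0`, the vectors `x`, `l`, `u`, `b` are in the
arrays `0`, `1`, `2`, `3`, and everything else is zero. -/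
def inputState {r s t n : ℕ} (b : Fin r ⊕ Fin n × Fin s → ℤ) (l u x : Fin n × Fin t → ℤ) :
    State where
  reg k := if k = 0 then (n : ℤ) else 0
  arr v :=
    match v with
    | 0 => listArray finProdFinEquiv x
    | 1 => listArray finProdFinEquiv l
    | 2 => listArray finProdFinEquiv u
    | 3 => listArray (((Equiv.refl (Fin r)).sumCongr finProdFinEquiv).trans finSumFinEquiv) b
    | _ => 0

/-- The output read off a final state: `none` (the assertion that the given point is optimal) if
the register `0` holds `0`, and otherwise the vector stored in the array `0`. -/
def output (n t : ℕ) (σ : State) : Option (Fin n × Fin t → ℤ) :=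
  if σ.reg 0 = 0 then none else some (readBricks n t (σ.arr 0))

/-- The comparison oracle of `f`: asked about two vectors, it tells whether `f v ≤ f w`. -/
def comparisonOracle {n t : ℕ} (f : (Fin n × Fin t → ℝ) → ℝ) (v w : ℕ → ℤ) : Prop :=
  f (toReal (readBricks n t v)) ≤ f (toReal (readBricks n t w))

end NFold

namespace NFold

/-! ### The conformal order -/

/-! The point is that Graver basis elements of the `n`-fold product look simple from the side:
summed over any set of bricks, and in particular over the first `i` of them, they stay in a box
`[-B, B]^t` with `B` depending only on the bimatrix (`exists_graver_prefix_bound`). Indeed each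
brick lies in the kernel of `A₂` and is a conformal sum of Graver basis elements of `A₂`. The total
multiplicities `μ` of these satisfy `A₁ (∑ μ γ • γ) = 0`; a minimal nonzero solution below them,
distributed over the bricks, is a kernel element conformally below the given one, hence equal to it.
By Dickson's lemma there are only finitely many minimal `μ`.

A dynamic program therefore runs through the bricks with the points of the box as states, the state
being the sum of the changes made so far. A transition changes one brick of `x` by the difference of
two states, provided that it lies in the kernel of `A₂` and the bounds hold. States and transitions
are bounded in number independently of `n`, so a stage costs constant time. Only the best partial
solution of each state is kept. This needs nothing but comparisons: two partial solutions agree with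
`x` on the bricks still to come, and for separable `f` an equal change of equal entries changes both
values by the same amount (`arrayValue_addBlock_le`, `eval_relax`).

The final states in the kernel of `A₁` yield only feasible points (`readBricks_mem_feasibleSet`),
and every feasible Graver step is among them (`exists_toArray_mem_reach`). If the best of these
points does not improve on `x`, then no Graver step does, and convexity makes `x` optimal
(`optimal_of_graver_steps`). Otherwise its difference to `x` is the required step. -/

theorem conformal_coord_iff {a b : ℤ} :
    (0 ≤ a * b ∧ |a| ≤ |b|) ↔ (0 ≤ a ∧ a ≤ b) ∨ (b ≤ a ∧ a ≤ 0) := by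
  constructor
  · rintro ⟨h1, h2⟩
    rcases le_total 0 a with ha | ha <;> rcases le_total 0 b with hb | hb
    · rw [abs_of_nonneg ha, abs_of_nonneg hb] at h2; omega
    · rw [abs_of_nonneg ha, abs_of_nonpos hb] at h2
      have : a * b = 0 := le_antisymm (mul_nonpos_of_nonneg_of_nonpos ha hb) h1
      rcases mul_eq_zero.1 this with h | h <;> omega
    · rw [abs_of_nonpos ha, abs_of_nonneg hb] at h2
      have : a * b = 0 := le_antisymm (mul_nonpos_of_nonpos_of_nonneg ha hb) h1
      rcases mul_eq_zero.1 this with h | h <;> omega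
    · rw [abs_of_nonpos ha, abs_of_nonpos hb] at h2; omega
  · rintro (⟨h1, h2⟩ | ⟨h1, h2⟩)
    · exact ⟨mul_nonneg h1 (h1.trans h2), abs_le_abs_of_nonneg h1 h2⟩
    · exact ⟨mul_nonneg_of_nonpos_of_nonpos h2 (h1.trans h2), abs_le_abs_of_nonpos h2 h1⟩

/-- Replaces products and absolute values by linear inequalities, so that later facts about the
order fall to `omega`. -/
theorem conformalLE_iff {ι : Type*} {x y : ι → ℤ} :
    ConformalLE x y ↔ ∀ i, (0 ≤ x i ∧ x i ≤ y i) ∨ (y i ≤ x i ∧ x i ≤ 0) :=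
  forall_congr' fun _ => conformal_coord_iff

theorem ConformalLE.refl {ι : Type*} (x : ι → ℤ) : ConformalLE x x :=
  conformalLE_iff.2 fun i => by omega

theorem ConformalLE.trans {ι : Type*} {x y z : ι → ℤ} (h : ConformalLE x y)
    (h' : ConformalLE y z) : ConformalLE x z :=
  conformalLE_iff.2 fun i => by
    have h1 := conformalLE_iff.1 h i
    have h2 := conformalLE_iff.1 h' i
    omega

theorem ConformalLE.sub_left {ι : Type*} {x y : ι → ℤ} (h : ConformalLE x y) :
    ConformalLE (y - x) y :=
  conformalLE_iff.2 fun i => by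
    have h1 := conformalLE_iff.1 h i
    simp only [Pi.sub_apply]
    omega

/-- The `ℓ₁`-norm of an integer vector. -/
def l1Norm {ι : Type*} [Fintype ι] (v : ι → ℤ) : ℕ := ∑ i, (v i).natAbs

/-- Makes the `ℓ₁`-norm a termination measure for every descent along the conformal order. -/
theorem ConformalLE.l1Norm_lt {ι : Type*} [Fintype ι] {x y : ι → ℤ} (h : ConformalLE x y)
    (hne : x ≠ y) : l1Norm x < l1Norm y := by
  obtain ⟨i, hi⟩ := Function.ne_iff.1 hne
  refine Finset.sum_lt_sum (fun j _ => ?_) ⟨i, Finset.mem_univ i, ?_⟩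
  · have := conformalLE_iff.1 h j
    omega
  · have := conformalLE_iff.1 h i
    omega

/-! ### Graver bases -/

theorem exists_graver_conformalLE {κ ι : Type*} [Fintype ι] (M : Matrix κ ι ℤ) (v : ι → ℤ)
    (hv : M.mulVec v = 0) (h0 : v ≠ 0) : ∃ g ∈ graverBasis M, ConformalLE g v := by
  induction hN : l1Norm v using Nat.strong_induction_on generalizing v with
  | _ N ih =>
    by_cases hmin : ∀ h : ι → ℤ, M.mulVec h = 0 → h ≠ 0 → ConformalLE h v → h = v
    · exact ⟨v, ⟨⟨hv, h0⟩, hmin⟩, ConformalLE.refl v⟩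
    · push Not at hmin
      obtain ⟨h, hk, hn, hc, hne⟩ := hmin
      obtain ⟨g, hg, hgc⟩ := ih _ (hN ▸ hc.l1Norm_lt hne) h hk hn rfl
      exact ⟨g, hg, hgc.trans hc⟩

/-- Dickson's lemma: splitting vectors into positive and negative parts sends the Graver basis
injectively to an antichain of a finite power of `ℕ × ℕ`. -/
theorem graverBasis_finite {κ ι : Type*} [Fintype ι] (M : Matrix κ ι ℤ) :
    (graverBasis M).Finite := by
  let e : (ι → ℤ) → (ι → ℕ × ℕ) := fun v i => ((v i).toNat, (-v i).toNat)
  have he : ∀ v w, e v ≤ e w → ConformalLE v w := fun v w h => conformalLE_iff.2 fun i => by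
    have := h i
    simp only [e, Prod.mk_le_mk] at this
    omega
  have hinj : Function.Injective e := fun v w h => funext fun i => by
    have := congrFun h i
    simp only [e, Prod.mk.injEq] at this
    omega
  refine Set.Finite.of_finite_image (f := e) ?_ hinj.injOn
  refine WellQuasiOrderedLE.finite_of_isAntichain ?_
  rintro _ ⟨v, hv, rfl⟩ _ ⟨w, hw, rfl⟩ hne hle
  exact hne (congrArg e (hw.2 v hv.1.1 hv.1.2 (he v w hle)))

/-- Subtract a Graver basis element conformally below `v` and repeat; the remainder stays
conformally below `v`, so all summands do as well. -/
theorem exists_conformal_decomposition {κ ι : Type*} [Fintype ι] (M : Matrix κ ι ℤ)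
    [Fintype (graverBasis M)] (v : ι → ℤ) (hv : M.mulVec v = 0) :
    ∃ c : graverBasis M → ℕ, (∑ γ, c γ • γ.1 = v) ∧ ∀ γ, c γ ≠ 0 → ConformalLE γ.1 v := by
  classical
  induction hN : l1Norm v using Nat.strong_induction_on generalizing v with
  | _ N ih =>
    by_cases h0 : v = 0
    · exact ⟨0, by simp [h0], by simp⟩
    · obtain ⟨g, hg, hgc⟩ := exists_graver_conformalLE M v hv h0
      have hne : v - g ≠ v := fun h => hg.1.2 (by simpa using h)
      obtain ⟨c, hc, hcc⟩ := ih _ (hN ▸ hgc.sub_left.l1Norm_lt hne) (v - g)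
        (by rw [Matrix.mulVec_sub, hv, hg.1.1, sub_zero]) rfl
      refine ⟨c + Pi.single ⟨g, hg⟩ 1, ?_, fun γ hγ => ?_⟩
      · simp only [Pi.add_apply, add_smul, Finset.sum_add_distrib, hc]
        rw [Finset.sum_eq_single ⟨g, hg⟩ (fun b _ hb => by simp [Pi.single_eq_of_ne hb])
          (by simp)]
        simp
      · by_cases hγg : γ = ⟨g, hg⟩
        · subst hγg; exact hgc
        · refine (hcc γ ?_).trans hgc.sub_left
          simpa [Pi.single_eq_of_ne hγg] using hγ

/-- All vectors that occur have the sign pattern of `v`, so nothing cancels in any coordinate and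
the sums are monotone in the multiplicities. -/
theorem conformalLE_sum_smul {ι Γ : Type*} [Fintype Γ] (w : Γ → ι → ℤ) (v : ι → ℤ)
    {c c' : Γ → ℕ} (hle : c ≤ c') (hs : ∀ γ, c' γ ≠ 0 → ConformalLE (w γ) v) :
    ConformalLE (∑ γ, c γ • w γ) (∑ γ, c' γ • w γ) := by
  refine conformalLE_iff.2 fun i => ?_
  simp only [Finset.sum_apply, Pi.smul_apply]
  simp only [nsmul_eq_mul]
  have hle' : ∀ γ, (c γ : ℤ) ≤ c' γ := fun γ => by exact_mod_cast hle γ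
  rcases le_total 0 (v i) with hv | hv
  · left
    have hw : ∀ γ, c' γ ≠ 0 → 0 ≤ w γ i := fun γ hγ => by
      have := conformalLE_iff.1 (hs γ hγ) i
      omega
    constructor
    · refine Finset.sum_nonneg fun γ _ => ?_
      by_cases h : c' γ = 0
      · simp [Nat.le_zero.1 (h ▸ hle γ)]
      · exact mul_nonneg (by positivity) (hw γ h)
    · refine Finset.sum_le_sum fun γ _ => ?_
      by_cases h : c' γ = 0
      · simp [Nat.le_zero.1 (h ▸ hle γ), h]
      · exact mul_le_mul_of_nonneg_right (hle' γ) (hw γ h)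
  · right
    have hw : ∀ γ, c' γ ≠ 0 → w γ i ≤ 0 := fun γ hγ => by
      have := conformalLE_iff.1 (hs γ hγ) i
      omega
    constructor
    · refine Finset.sum_le_sum fun γ _ => ?_
      by_cases h : c' γ = 0
      · simp [Nat.le_zero.1 (h ▸ hle γ), h]
      · exact mul_le_mul_of_nonpos_right (hle' γ) (hw γ h)
    · refine Finset.sum_nonpos fun γ _ => ?_
      by_cases h : c' γ = 0
      · simp [Nat.le_zero.1 (h ▸ hle γ)]
      · exact mul_nonpos_of_nonneg_of_nonpos (by positivity) (hw γ h)

/-- Serves to distribute a smaller total multiplicity over the bricks without exceeding the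
multiplicity in any of them. -/
theorem exists_le_sum_eq {ι : Type*} [Fintype ι] (c : ι → ℕ) (m : ℕ) (hm : m ≤ ∑ i, c i) :
    ∃ c' : ι → ℕ, (∀ i, c' i ≤ c i) ∧ ∑ i, c' i = m := by
  classical
  induction m with
  | zero => exact ⟨0, by simp⟩
  | succ m ih =>
    obtain ⟨c', h1, h2⟩ := ih (by omega)
    obtain ⟨i, -, hi⟩ := Finset.exists_lt_of_sum_lt (s := Finset.univ) (f := c') (g := c)
      (by omega)
    refine ⟨c' + Pi.single i 1, fun j => ?_, ?_⟩
    · by_cases h : j = i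
      · subst h; simpa using hi
      · simpa [Pi.single_eq_of_ne h] using h1 j
    · simp [Finset.sum_add_distrib, h2]

/-! ### The `n`-fold product -/

/-- The `i`-th brick of a vector. -/
def brick {n t : ℕ} {R : Type*} (v : Fin n × Fin t → R) (i : Fin n) : Fin t → R :=
  fun j => v (i, j)

theorem nFoldProduct_mulVec_eq_iff {r s t n : ℕ} (A₁ : Matrix (Fin r) (Fin t) ℤ)
    (A₂ : Matrix (Fin s) (Fin t) ℤ) (v : Fin n × Fin t → ℤ) (b : Fin r ⊕ Fin n × Fin s → ℤ) :
    (nFoldProduct n A₁ A₂).mulVec v = b ↔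
      A₁.mulVec (∑ i, brick v i) = (fun k => b (Sum.inl k)) ∧
        ∀ i, A₂.mulVec (brick v i) = fun k => b (Sum.inr (i, k)) := by
  have h1 : ∀ k, (nFoldProduct n A₁ A₂).mulVec v (Sum.inl k) =
      A₁.mulVec (∑ i, brick v i) k := fun k => by
    simp only [Matrix.mulVec, dotProduct, nFoldProduct, Fintype.sum_prod_type, Finset.sum_apply,
      Finset.mul_sum, brick]
    exact Finset.sum_comm
  have h2 : ∀ i k, (nFoldProduct n A₁ A₂).mulVec v (Sum.inr (i, k)) =
      A₂.mulVec (brick v i) k := fun i k => by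
    simp only [Matrix.mulVec, dotProduct, nFoldProduct, Fintype.sum_prod_type, brick]
    rw [Finset.sum_eq_single i (fun b _ hb => by simp [Ne.symm hb]) (by simp)]
    simp
  constructor
  · rintro rfl
    exact ⟨funext fun k => (h1 k).symm, fun i => funext fun k => (h2 i k).symm⟩
  · rintro ⟨H1, H2⟩
    funext row
    rcases row with k | ⟨i, k⟩
    · rw [h1, H1]
    · rw [h2, H2]

theorem exists_graver_prefix_bound {r s t : ℕ} (A₁ : Matrix (Fin r) (Fin t) ℤ)
    (A₂ : Matrix (Fin s) (Fin t) ℤ) :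
    ∃ B : ℕ, ∀ (n : ℕ), ∀ g ∈ graverBasis (nFoldProduct n A₁ A₂),
      ∀ (I : Finset (Fin n)) (j : Fin t), |∑ i ∈ I, g (i, j)| ≤ B := by
  classical
  have := (graverBasis_finite A₂).fintype
  -- The total multiplicities forget `n` and the positions of the bricks; this is why the bound is
  -- uniform in `n`.
  let Q : (graverBasis A₂ → ℕ) → Prop := fun μ => μ ≠ 0 ∧ A₁.mulVec (∑ γ, μ γ • γ.1) = 0
  have hfin : {μ | Minimal Q μ}.Finite :=
    WellQuasiOrderedLE.finite_of_isAntichain (setOfPred_minimal_antichain Q)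
  refine ⟨∑ μ ∈ hfin.toFinset, ∑ γ, μ γ * ∑ j, (γ.1 j).natAbs, fun n g hg I j => ?_⟩
  obtain ⟨⟨hgk, hg0⟩, hgmin⟩ := hg
  obtain ⟨hg1, hg2⟩ := (nFoldProduct_mulVec_eq_iff A₁ A₂ g 0).1 hgk
  choose c hc hcc using fun i => exists_conformal_decomposition A₂ (brick g i) (hg2 i)
  have hQ : Q (fun γ => ∑ i, c i γ) := by
    refine ⟨fun h => hg0 ?_, ?_⟩
    · have hz : ∀ i γ, c i γ = 0 := fun i γ => by
        have := congrFun h γ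
        exact Finset.sum_eq_zero_iff.1 this i (Finset.mem_univ i)
      funext p
      have := congrFun (hc p.1) p.2
      simpa [hz, brick] using this.symm
    · have : ∑ γ, (∑ i, c i γ) • γ.1 = ∑ i, brick g i := by
        simp only [Finset.sum_smul]
        rw [Finset.sum_comm]
        exact Finset.sum_congr rfl fun i _ => hc i
      rw [this]
      exact hg1
  obtain ⟨μ, hμle, hμ⟩ := exists_minimal_le_of_wellFoundedLT Q _ hQ
  choose c' hc'le hc' using fun γ => exists_le_sum_eq (fun i => c i γ) (μ γ) (hμle γ)
  let h : Fin n × Fin t → ℤ := fun p => (∑ γ, c' γ p.1 • γ.1) p.2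
  have hbrick : ∀ i, brick h i = ∑ γ, c' γ i • γ.1 := fun i => rfl
  have hsum : ∑ i, brick h i = ∑ γ, μ γ • γ.1 := by
    simp only [hbrick, ← hc', Finset.sum_smul]
    exact Finset.sum_comm
  have hk : (nFoldProduct n A₁ A₂).mulVec h = 0 := by
    refine (nFoldProduct_mulVec_eq_iff A₁ A₂ h 0).2 ⟨by rw [hsum]; exact hμ.1.2, fun i => ?_⟩
    rw [hbrick, Matrix.mulVec_sum]
    refine Finset.sum_eq_zero fun γ _ => ?_
    rw [Matrix.mulVec_smul, γ.2.1.1, smul_zero]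
  have hconf : ConformalLE h g := fun p => by
    have := conformalLE_sum_smul (fun γ : graverBasis A₂ => γ.1) (brick g p.1)
      (c := fun γ => c' γ p.1) (c' := c p.1) (fun γ => hc'le γ p.1) (hcc p.1)
    rw [hc] at this
    exact this p.2
  have hne : h ≠ 0 := by
    obtain ⟨γ, hγ⟩ := Function.ne_iff.1 hμ.1.1
    have : ∃ i, c' γ i ≠ 0 := by
      by_contra! hcon
      exact hγ (by rw [← hc' γ]; simp [hcon])
    obtain ⟨i, hi⟩ := this
    -- A basis element `γ` used in brick `i` is conformally below that brick of `h`, so its nonzero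
    -- coordinate `j` cannot have been cancelled.
    obtain ⟨j, hj⟩ := Function.ne_iff.1 γ.2.1.2
    intro h0
    have hconf' := conformalLE_sum_smul (fun γ : graverBasis A₂ => γ.1) (brick g i)
      (c := Pi.single γ 1) (c' := fun γ => c' γ i) (fun δ => ?_) (fun δ hδ => hcc i δ ?_)
    · have hz : (∑ γ, c' γ i • γ.1) j = 0 := congrFun h0 (i, j)
      have h2 := conformalLE_iff.1 hconf' j
      rw [hz, Finset.sum_eq_single γ (fun b _ hb => by simp [Pi.single_eq_of_ne hb])
        (by simp)] at h2
      simp only [Pi.single_eq_same, one_smul] at h2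
      exact hj (by simp only [Pi.zero_apply]; omega)
    · by_cases hd : δ = γ
      · subst hd; simpa using Nat.one_le_iff_ne_zero.2 hi
      · simp [Pi.single_eq_of_ne hd]
    · have := hc'le δ i
      omega
  have hhg : h = g := hgmin h hk hne hconf
  have hterm : ∀ i, |g (i, j)| ≤ ∑ γ : graverBasis A₂, (c' γ i : ℤ) * |γ.1 j| := fun i => by
    rw [← hhg]
    simp only [h, Finset.sum_apply, Pi.smul_apply]
    simp only [nsmul_eq_mul]
    refine (Finset.abs_sum_le_sum_abs _ _).trans (le_of_eq ?_)
    exact Finset.sum_congr rfl fun γ _ => by rw [abs_mul, Nat.abs_cast]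
  calc |∑ i ∈ I, g (i, j)| ≤ ∑ i ∈ I, |g (i, j)| := Finset.abs_sum_le_sum_abs _ _
    _ ≤ ∑ i, |g (i, j)| :=
        Finset.sum_le_sum_of_subset_of_nonneg (Finset.subset_univ I) fun _ _ _ => abs_nonneg _
    _ ≤ ∑ i, ∑ γ : graverBasis A₂, (c' γ i : ℤ) * |γ.1 j| :=
        Finset.sum_le_sum fun i _ => hterm i
    _ = ∑ γ : graverBasis A₂, (μ γ : ℤ) * |γ.1 j| := by
        rw [Finset.sum_comm]
        refine Finset.sum_congr rfl fun γ _ => ?_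
        rw [← hc' γ, Nat.cast_sum, Finset.sum_mul]
    _ ≤ ∑ γ : graverBasis A₂, (μ γ : ℤ) * ∑ j, |γ.1 j| :=
        Finset.sum_le_sum fun γ _ => mul_le_mul_of_nonneg_left
          (Finset.single_le_sum (f := fun j => |γ.1 j|) (fun _ _ => abs_nonneg _)
            (Finset.mem_univ j)) (by positivity)
    _ = ((∑ γ : graverBasis A₂, μ γ * ∑ j, (γ.1 j).natAbs : ℕ) : ℤ) := by
        push_cast
        rfl
    _ ≤ _ := by
        exact_mod_cast Finset.single_le_sum
          (f := fun μ : graverBasis A₂ → ℕ => ∑ γ, μ γ * ∑ j, (γ.1 j).natAbs)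
          (fun _ _ => Nat.zero_le _) (hfin.mem_toFinset.2 hμ)

/-! ### The optimality criterion -/

/-- The two inner points are convex combinations of `a` and `a + d` with interchanged weights `1 - e
/ d` and `e / d`; add the two convexity inequalities. -/
theorem ConvexOn.add_le_add_of_between {φ : ℝ → ℝ} (hφ : ConvexOn ℝ Set.univ φ) {a e d : ℝ}
    (h : (0 ≤ e ∧ e ≤ d) ∨ (d ≤ e ∧ e ≤ 0)) :
    φ (a + e) + φ (a + d - e) ≤ φ a + φ (a + d) := by
  by_cases hd : d = 0
  · have he : e = 0 := by rcases h with h | h <;> linarith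
    simp [hd, he]
  · have h0 : 0 ≤ e / d := by
      rcases h with h | h
      · exact div_nonneg h.1 (h.1.trans h.2)
      · exact div_nonneg_of_nonpos h.2 (h.1.trans h.2)
    have h1 : 0 ≤ 1 - e / d := by
      have : 1 - e / d = (d - e) / d := by field_simp
      rw [this]
      rcases h with h | h
      · exact div_nonneg (by linarith) (h.1.trans h.2)
      · exact div_nonneg_of_nonpos (by linarith) (h.1.trans h.2)
    have e1 := hφ.2 (Set.mem_univ a) (Set.mem_univ (a + d)) h1 h0 (by ring)
    have e2 := hφ.2 (Set.mem_univ a) (Set.mem_univ (a + d)) h0 h1 (by ring)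
    have c1 : (1 - e / d) • a + (e / d) • (a + d) = a + e := by
      simp only [smul_eq_mul]; field_simp; ring
    have c2 : (e / d) • a + (1 - e / d) • (a + d) = a + d - e := by
      simp only [smul_eq_mul]; field_simp; ring
    rw [c1] at e1
    rw [c2] at e2
    simp only [smul_eq_mul] at e1 e2
    linarith

/-- Induction on the distance from `x` to `y`. For a Graver basis element `g` conformally below `y -
x`, both `x + g` and `y - g` lie between `x` and `y`, hence are feasible, and `f (x + g) + f (y - g)
≤ f x + f y`. Since `g` does not improve `x`, passing from `y` to the closer point `y - g` does not
increase `f`. -/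
theorem optimal_of_graver_steps {κ ι : Type*} [Fintype ι] (M : Matrix κ ι ℤ) (b : κ → ℤ)
    (l u x : ι → ℤ) (f : (ι → ℝ) → ℝ) (hf : SeparableConvex f) (hx : x ∈ feasibleSet M b l u)
    (hstep : ∀ g ∈ graverBasis M, x + g ∈ feasibleSet M b l u →
      f (toReal x) ≤ f (toReal (x + g)))
    (y : ι → ℤ) (hy : y ∈ feasibleSet M b l u) : f (toReal x) ≤ f (toReal y) := by
  obtain ⟨φ, hφ, hfφ⟩ := hf
  induction hN : l1Norm (y - x) using Nat.strong_induction_on generalizing y with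
  | _ N ih =>
    by_cases h0 : y - x = 0
    · rw [sub_eq_zero.1 h0]
    · obtain ⟨g, hg, hgc⟩ := exists_graver_conformalLE M (y - x)
        (by rw [Matrix.mulVec_sub, hx.1, hy.1, sub_self]) h0
      have hxg : x + g ∈ feasibleSet M b l u := by
        refine ⟨by rw [Matrix.mulVec_add, hx.1, hg.1.1, add_zero], fun i => ?_, fun i => ?_⟩ <;>
        · have h1 := conformalLE_iff.1 hgc i
          have h2 := hx.2.1 i
          have h3 := hx.2.2 i
          have h4 := hy.2.1 i
          have h5 := hy.2.2 i
          simp only [Pi.sub_apply, Pi.add_apply] at *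
          omega
      have hyg : y - g ∈ feasibleSet M b l u := by
        refine ⟨by rw [Matrix.mulVec_sub, hy.1, hg.1.1, sub_zero], fun i => ?_, fun i => ?_⟩ <;>
        · have h1 := conformalLE_iff.1 hgc i
          have h2 := hx.2.1 i
          have h3 := hx.2.2 i
          have h4 := hy.2.1 i
          have h5 := hy.2.2 i
          simp only [Pi.sub_apply] at *
          omega
      have hlt : l1Norm (y - g - x) < N := by
        have hne : y - x - g ≠ y - x := fun h => hg.1.2 (by simpa using h)
        rw [sub_right_comm, ← hN]
        exact hgc.sub_left.l1Norm_lt hne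
      have h1 := ih _ hlt (y - g) hyg rfl
      have h2 := hstep g hg hxg
      have h3 : f (toReal (x + g)) + f (toReal (y - g)) ≤ f (toReal x) + f (toReal y) := by
        simp only [hfφ, ← Finset.sum_add_distrib]
        refine Finset.sum_le_sum fun i _ => ?_
        have hi : (0 ≤ (g i : ℝ) ∧ (g i : ℝ) ≤ (y i : ℝ) - x i) ∨
            ((y i : ℝ) - x i ≤ g i ∧ (g i : ℝ) ≤ 0) := by
          have := conformalLE_iff.1 hgc i
          simp only [Pi.sub_apply] at this
          exact_mod_cast this
        have := ConvexOn.add_le_add_of_between (hφ i) (a := x i) hi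
        simpa [toReal] using this
      linarith

/-! ### Partial solutions of the dynamic program -/

/-- The array `a` after `d 0, …, d (m - 1)` have been added to its entries from `p` on. -/
def addBlock (p m : ℕ) (d a : ℕ → ℤ) : ℕ → ℤ :=
  fun q => if p ≤ q ∧ q < p + m then a q + d (q - p) else a q

/-- The vector `z` followed by zeros. -/
def extendZero {t : ℕ} (z : Fin t → ℤ) : ℕ → ℤ := fun j => if h : j < t then z ⟨j, h⟩ else 0

/-- The entries of `a` from `p` to `p + m - 1` lie between those of `l` and `u`. -/
def InBounds (l u : ℕ → ℤ) (p m : ℕ) (a : ℕ → ℤ) : Prop :=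
  ∀ q, p ≤ q → q < p + m → l q ≤ a q ∧ a q ≤ u q

/-- The arrays obtained from those in `S` by adding `d` to the block of length `m` at `p`, as far
as they respect the bounds there. -/
def extensions (l u : ℕ → ℤ) (p m : ℕ) (d : ℕ → ℤ) (S : Set (ℕ → ℤ)) : Set (ℕ → ℤ) :=
  {a | ∃ a₀ ∈ S, a = addBlock p m d a₀ ∧ InBounds l u p m a}

/-- The arrays that arise from `x` by changing the first `i` bricks within the bounds by elements
of the kernel of `A₂`, such that all partial sums of the changes are among the vectors `z k`, and
the last one is `z k`. -/
def reach {s t m : ℕ} (A₂ : Matrix (Fin s) (Fin t) ℤ) (z : Fin m → Fin t → ℤ)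
    (l u x : ℕ → ℤ) : ℕ → Fin m → Set (ℕ → ℤ)
  | 0, k => {a | a = x ∧ z k = 0}
  | i + 1, k' => {a | ∃ k, A₂.mulVec (z k' - z k) = 0 ∧
      a ∈ extensions l u (i * t) t (extendZero (z k' - z k)) (reach A₂ z l u x i k)}

theorem addBlock_of_lt {p m q : ℕ} (d a : ℕ → ℤ) (h : q < p) : addBlock p m d a q = a q :=
  if_neg fun h' => absurd h'.1 (not_le.2 h)

theorem addBlock_of_ge {p m q : ℕ} (d a : ℕ → ℤ) (h : p + m ≤ q) : addBlock p m d a q = a q :=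
  if_neg fun h' => absurd h'.2 (not_lt.2 h)

theorem addBlock_add {p m j : ℕ} (d a : ℕ → ℤ) (h : j < m) :
    addBlock p m d a (p + j) = a (p + j) + d j := by
  simp [addBlock, h]

theorem extendZero_apply {t : ℕ} (z : Fin t → ℤ) (j : Fin t) : extendZero z j = z j := by
  simp [extendZero]

/-- Competing partial solutions thus agree on the block treated next, which is what allows
discarding all but the best. -/
theorem eq_of_mem_reach {s t m : ℕ} {A₂ : Matrix (Fin s) (Fin t) ℤ} {z : Fin m → Fin t → ℤ}
    {l u x : ℕ → ℤ} {i : ℕ} {k : Fin m} {a : ℕ → ℤ} (ha : a ∈ reach A₂ z l u x i k) {q : ℕ}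
    (hq : i * t ≤ q) : a q = x q := by
  induction i generalizing a k with
  | zero => rw [ha.1]
  | succ i ih =>
    obtain ⟨k', -, a₀, ha₀, rfl, -⟩ := ha
    rw [Nat.succ_mul] at hq
    rw [addBlock_of_ge _ _ hq]
    exact ih ha₀ (by omega)

/-- The value of `f` at the vector stored in an array. -/
def arrayValue {n t : ℕ} (f : (Fin n × Fin t → ℝ) → ℝ) (a : ℕ → ℤ) : ℝ :=
  f (toReal (readBricks n t a))

/-- The principle of optimality. By separability the increment of `f` depends only on the entries in
the block, where the arrays agree; convexity plays no role. -/
theorem arrayValue_addBlock_le {n t : ℕ} {f : (Fin n × Fin t → ℝ) → ℝ} (hf : SeparableConvex f)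
    {p m : ℕ} (d : ℕ → ℤ) {a a' : ℕ → ℤ} (haa' : ∀ q, p ≤ q → q < p + m → a q = a' q)
    (h : arrayValue f a ≤ arrayValue f a') :
    arrayValue f (addBlock p m d a) ≤ arrayValue f (addBlock p m d a') := by
  obtain ⟨φ, -, hφ⟩ := hf
  have key : arrayValue f (addBlock p m d a) + arrayValue f a' =
      arrayValue f (addBlock p m d a') + arrayValue f a := by
    simp only [arrayValue, hφ, ← Finset.sum_add_distrib]
    refine Finset.sum_congr rfl fun c _ => ?_
    simp only [toReal, readBricks, addBlock]
    split_ifs with hc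
    · rw [haa' _ hc.1 hc.2]
    · ring
  linarith

/-- The `i`-th block of length `t` of an array. -/
def block (t : ℕ) (a : ℕ → ℤ) (i : ℕ) : Fin t → ℤ := fun j => a (i * t + j)

theorem block_addBlock_self {t i : ℕ} (z : Fin t → ℤ) (a : ℕ → ℤ) :
    block t (addBlock (i * t) t (extendZero z) a) i = block t a i + z := by
  funext j
  simp only [block, Pi.add_apply]
  rw [addBlock_add _ _ j.2, extendZero_apply]

theorem block_index_lt {t i i' : ℕ} (h : i' < i) (j : Fin t) : i' * t + j < i * t := by
  have h1 : (i' + 1) * t ≤ i * t := Nat.mul_le_mul_right t h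
  rw [Nat.succ_mul] at h1
  have := j.2
  omega

theorem exists_block_index {t i q : ℕ} (hq : q < i * t) :
    ∃ i' < i, ∃ j : Fin t, q = i' * t + j := by
  have ht : 0 < t := Nat.pos_of_ne_zero fun h => by simp [h] at hq
  refine ⟨q / t, (Nat.div_lt_iff_lt_mul ht).2 hq, ⟨q % t, Nat.mod_lt _ ht⟩, ?_⟩
  exact (Nat.div_add_mod' q t).symm

theorem block_addBlock_of_lt {t i i' : ℕ} (h : i' < i) (d a : ℕ → ℤ) :
    block t (addBlock (i * t) t d a) i' = block t a i' := by
  funext j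
  exact addBlock_of_lt _ _ (block_index_lt h j)

/-- Soundness of the dynamic program: the differences of consecutive states telescope to the last
one. -/
theorem properties_of_mem_reach {s t m : ℕ} {A₂ : Matrix (Fin s) (Fin t) ℤ}
    {z : Fin m → Fin t → ℤ} {l u x : ℕ → ℤ} {i : ℕ} {k : Fin m} {a : ℕ → ℤ}
    (ha : a ∈ reach A₂ z l u x i k) :
    (∀ i' < i, A₂.mulVec (block t a i' - block t x i') = 0) ∧
      ∑ i' ∈ Finset.range i, (block t a i' - block t x i') = z k ∧ InBounds l u 0 (i * t) a := by
  induction i generalizing a k with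
  | zero => exact ⟨by simp, by simpa using ha.2.symm, fun q _ h => by simp at h⟩
  | succ i ih =>
    obtain ⟨k', hk', a₀, ha₀, rfl, hb⟩ := ha
    obtain ⟨h1, h2, h3⟩ := ih ha₀
    have hlast : block t a₀ i = block t x i :=
      funext fun j => eq_of_mem_reach ha₀ (Nat.le_add_right _ _)
    refine ⟨fun i' hi' => ?_, ?_, fun q _ hq => ?_⟩
    · rcases Nat.lt_succ_iff_lt_or_eq.1 hi' with hlt | rfl
      · rw [block_addBlock_of_lt hlt]
        exact h1 i' hlt
      · rw [block_addBlock_self, hlast, add_sub_cancel_left]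
        exact hk'
    · rw [Finset.sum_range_succ, block_addBlock_self, hlast, add_sub_cancel_left,
        Finset.sum_congr rfl fun i' hi' => by
          rw [block_addBlock_of_lt (Finset.mem_range.1 hi')], h2]
      abel
    · rw [Nat.succ_mul, zero_add] at hq
      by_cases hlt : q < i * t
      · rw [addBlock_of_lt _ _ hlt]
        exact h3 q (Nat.zero_le q) (by omega)
      · exact hb q (by omega) hq

/-- Completeness of the dynamic program: the path through the prefix sums of the changes reaches `a`
cut off after `i` bricks and continued by `x`. -/
theorem truncation_mem_reach {s t m n : ℕ} {A₂ : Matrix (Fin s) (Fin t) ℤ}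
    {z : Fin m → Fin t → ℤ} {l u x a : ℕ → ℤ}
    (hA : ∀ i < n, A₂.mulVec (block t a i - block t x i) = 0)
    (hz : ∀ i ≤ n, ∃ k, z k = ∑ i' ∈ Finset.range i, (block t a i' - block t x i'))
    (hb : InBounds l u 0 (n * t) a) {i : ℕ} (hi : i ≤ n) {k : Fin m}
    (hk : z k = ∑ i' ∈ Finset.range i, (block t a i' - block t x i')) :
    (fun q => if q < i * t then a q else x q) ∈ reach A₂ z l u x i k := by
  induction i generalizing k with
  | zero => exact ⟨by simp, by simpa using hk⟩
  | succ i ih =>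
    obtain ⟨k', hk'⟩ := hz i (by omega)
    have hdiff : z k - z k' = block t a i - block t x i := by
      rw [hk, hk', Finset.sum_range_succ, add_sub_cancel_left]
    refine ⟨k', by rw [hdiff]; exact hA i hi, _, ih (by omega) hk', ?_, ?_⟩
    · funext q
      rw [Nat.succ_mul]
      rcases lt_or_ge q (i * t) with h1 | h1
      · rw [addBlock_of_lt _ _ h1, if_pos h1, if_pos (by omega)]
      · rcases lt_or_ge q (i * t + t) with h2 | h2
        · obtain ⟨j, rfl⟩ := Nat.exists_eq_add_of_le h1
          have hj : j < t := by omega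
          rw [if_pos h2, addBlock_add _ _ hj, if_neg (by omega), hdiff]
          have := extendZero_apply (block t a i - block t x i) ⟨j, hj⟩
          simp only [Pi.sub_apply, block] at this
          rw [this]
          ring
        · rw [addBlock_of_ge _ _ h2, if_neg (by omega), if_neg (by omega)]
    · intro q h1 h2
      have h3 : q < (i + 1) * t := by rw [Nat.succ_mul]; exact h2
      simp only [if_pos h3]
      have := Nat.mul_le_mul_right t hi
      exact hb q (Nat.zero_le q) (by omega)

/-! ### Vectors and arrays -/

/-- The array that lists the bricks of a vector. -/
abbrev toArray {n t : ℕ} (v : Fin n × Fin t → ℤ) : ℕ → ℤ := listArray finProdFinEquiv v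

theorem toArray_index {n t : ℕ} (v : Fin n × Fin t → ℤ) (i : Fin n) (j : Fin t) :
    toArray v (i * t + j) = v (i, j) := by
  have h : (i : ℕ) * t + j < n * t := block_index_lt i.2 j
  have h' : (⟨i * t + j, h⟩ : Fin (n * t)) = finProdFinEquiv (i, j) := by
    ext
    simp [finProdFinEquiv_apply_val, mul_comm, add_comm]
  simp [toArray, listArray, h, h']

theorem toArray_of_ge {n t q : ℕ} (v : Fin n × Fin t → ℤ) (h : n * t ≤ q) : toArray v q = 0 :=
  dif_neg (not_lt.2 h)

theorem readBricks_toArray {n t : ℕ} (v : Fin n × Fin t → ℤ) :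
    readBricks n t (toArray v) = v :=
  funext fun p => toArray_index v p.1 p.2

theorem block_toArray {n t : ℕ} (v : Fin n × Fin t → ℤ) (i : Fin n) :
    block t (toArray v) i = brick v i :=
  funext fun j => toArray_index v i j

theorem readBricks_mem_feasibleSet {r s t m n : ℕ} {A₁ : Matrix (Fin r) (Fin t) ℤ}
    {A₂ : Matrix (Fin s) (Fin t) ℤ} {z : Fin m → Fin t → ℤ} {b : Fin r ⊕ Fin n × Fin s → ℤ}
    {l u x : Fin n × Fin t → ℤ} (hx : x ∈ feasibleSet (nFoldProduct n A₁ A₂) b l u) {k : Fin m}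
    (hk : A₁.mulVec (z k) = 0) {a : ℕ → ℤ}
    (ha : a ∈ reach A₂ z (toArray l) (toArray u) (toArray x) n k) :
    readBricks n t a ∈ feasibleSet (nFoldProduct n A₁ A₂) b l u := by
  obtain ⟨h1, h2, h3⟩ := properties_of_mem_reach ha
  have hbr : ∀ i : Fin n, block t a i - block t (toArray x) i =
      brick (readBricks n t a - x) i := fun i => by rw [block_toArray]; rfl
  have hker : (nFoldProduct n A₁ A₂).mulVec (readBricks n t a - x) = 0 := by
    refine (nFoldProduct_mulVec_eq_iff _ _ _ _).2 ⟨?_, fun i => ?_⟩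
    · simp only [← hbr]
      rw [Fin.sum_univ_eq_sum_range (fun i => block t a i - block t (toArray x) i), h2]
      exact hk
    · rw [← hbr]
      exact h1 i i.2
  have hb : ∀ p : Fin n × Fin t, l p ≤ readBricks n t a p ∧ readBricks n t a p ≤ u p :=
    fun ⟨i, j⟩ => by
      have := h3 (i * t + j) (Nat.zero_le _) (by simpa using block_index_lt i.2 j)
      rwa [toArray_index, toArray_index] at this
  refine ⟨?_, fun p => (hb p).1, fun p => (hb p).2⟩
  rw [Matrix.mulVec_sub, hx.1, sub_eq_zero] at hker
  exact hker

theorem exists_toArray_mem_reach {r s t m n : ℕ} {A₁ : Matrix (Fin r) (Fin t) ℤ}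
    {A₂ : Matrix (Fin s) (Fin t) ℤ} {z : Fin m → Fin t → ℤ} {b : Fin r ⊕ Fin n × Fin s → ℤ}
    {l u x g : Fin n × Fin t → ℤ} (hg : (nFoldProduct n A₁ A₂).mulVec g = 0)
    (hxg : x + g ∈ feasibleSet (nFoldProduct n A₁ A₂) b l u)
    (hz : ∀ I : Finset (Fin n), ∃ k, z k = ∑ i ∈ I, brick g i) :
    ∃ k, A₁.mulVec (z k) = 0 ∧
      toArray (x + g) ∈ reach A₂ z (toArray l) (toArray u) (toArray x) n k := by
  obtain ⟨h1, h2⟩ := (nFoldProduct_mulVec_eq_iff _ _ _ _).1 hg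
  have hbr : ∀ i : Fin n, block t (toArray (x + g)) i - block t (toArray x) i = brick g i :=
    fun i => by
      rw [block_toArray, block_toArray]
      funext j
      simp [brick]
  have hsum : ∀ i ≤ n, ∃ k, z k =
      ∑ i' ∈ Finset.range i, (block t (toArray (x + g)) i' - block t (toArray x) i') := by
    intro i hi
    -- Only initial segments of bricks are needed as index sets.
    obtain ⟨k, hk⟩ := hz (Finset.univ.filter fun i' : Fin n => (i' : ℕ) < i)
    refine ⟨k, hk.trans ?_⟩
    rw [Finset.sum_filter, Finset.sum_congr rfl fun i' _ => by rw [← hbr i'],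
      Fin.sum_univ_eq_sum_range (fun i' => if i' < i then
        block t (toArray (x + g)) i' - block t (toArray x) i' else 0), ← Finset.sum_filter]
    refine Finset.sum_congr ?_ fun _ _ => rfl
    ext i'
    simp only [Finset.mem_filter, Finset.mem_range]
    omega
  obtain ⟨k, hk⟩ := hsum n le_rfl
  refine ⟨k, ?_, ?_⟩
  · rw [hk, ← Fin.sum_univ_eq_sum_range
      (fun i => block t (toArray (x + g)) i - block t (toArray x) i)]
    simp only [hbr]
    exact h1
  · have := truncation_mem_reach (A₂ := A₂) (z := z) (l := toArray l) (u := toArray u)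
      (x := toArray x) (a := toArray (x + g)) (n := n) (fun i hi => ?_) hsum ?_ le_rfl hk
    · convert this using 1
      funext q
      split_ifs with hq
      · rfl
      · rw [toArray_of_ge _ (not_lt.1 hq), toArray_of_ge _ (not_lt.1 hq)]
    · rw [hbr ⟨i, hi⟩]
      exact h2 ⟨i, hi⟩
    · intro q _ hq
      rw [zero_add] at hq
      obtain ⟨i, hi, j, rfl⟩ := exists_block_index hq
      have e := fun v : Fin n × Fin t → ℤ => toArray_index v ⟨i, hi⟩ j
      simp only at e
      rw [e, e, e]
      exact ⟨hxg.2.1 _, hxg.2.2 _⟩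

/-! ### Loop-free programs -/

/-- The program contains no loop. -/
def Prog.LoopFree : Prog → Prop
  | .seq P Q => P.LoopFree ∧ Q.LoopFree
  | .ite _ _ P Q => P.LoopFree ∧ Q.LoopFree
  | .query _ _ P Q => P.LoopFree ∧ Q.LoopFree
  | .loop _ _ _ => False
  | _ => True

/-- The number of instructions in a program text. -/
def Prog.size : Prog → ℕ
  | .skip => 0
  | .seq P Q => P.size + Q.size
  | .ite _ _ P Q => P.size + Q.size + 1
  | .query _ _ P Q => P.size + Q.size + 1
  | .loop _ _ P => P.size + 1
  | _ => 1

open Classical in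
/-- The final state of a loop-free program. -/
noncomputable def eval (O : (ℕ → ℤ) → (ℕ → ℤ) → Prop) : Prog → State → State
  | .skip, σ => σ
  | .const d c, σ => σ.setReg d c
  | .add d p q, σ => σ.setReg d (σ.reg p + σ.reg q)
  | .sub d p q, σ => σ.setReg d (σ.reg p - σ.reg q)
  | .load d v i, σ => σ.setReg d (σ.arr v (σ.reg i).toNat)
  | .store v i p, σ => σ.setArr v (Function.update (σ.arr v) (σ.reg i).toNat (σ.reg p))
  | .copy v w, σ => σ.setArr v (σ.arr w)
  | .seq P Q, σ => eval O Q (eval O P σ)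
  | .ite p q P Q, σ => if σ.reg p ≤ σ.reg q then eval O P σ else eval O Q σ
  | .query v w P Q, σ => if O (σ.arr v) (σ.arr w) then eval O P σ else eval O Q σ
  -- A junk value, irrelevant since `exec_eval` assumes `LoopFree`.
  | .loop _ _ _, σ => σ

/-- Without loops each instruction is executed at most once, so the length of the text bounds the
time. Relational reasoning is then needed for the two loops only. -/
theorem exec_eval (O : (ℕ → ℤ) → (ℕ → ℤ) → Prop) {P : Prog} (hP : P.LoopFree) (σ : State) :
    ∃ c ≤ P.size, Exec O P σ (eval O P σ) c := by
  induction P generalizing σ with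
  | skip => exact ⟨0, le_rfl, .skip σ⟩
  | const d c => exact ⟨1, le_rfl, .const σ d c⟩
  | add d p q => exact ⟨1, le_rfl, .add σ d p q⟩
  | sub d p q => exact ⟨1, le_rfl, .sub σ d p q⟩
  | load d v i => exact ⟨1, le_rfl, .load σ d v i⟩
  | store v i p => exact ⟨1, le_rfl, .store σ v i p⟩
  | copy v w => exact ⟨1, le_rfl, .copy σ v w⟩
  | seq P Q ihP ihQ =>
    obtain ⟨c, hc, h⟩ := ihP hP.1 σ
    obtain ⟨c', hc', h'⟩ := ihQ hP.2 (eval O P σ)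
    exact ⟨c + c', Nat.add_le_add hc hc', .seq h h'⟩
  | ite p q P Q ihP ihQ =>
    by_cases hle : σ.reg p ≤ σ.reg q
    · obtain ⟨c, hc, h⟩ := ihP hP.1 σ
      refine ⟨c + 1, by simp only [Prog.size]; omega, ?_⟩
      simp only [eval, if_pos hle]
      exact .ite_true hle h
    · obtain ⟨c, hc, h⟩ := ihQ hP.2 σ
      refine ⟨c + 1, by simp only [Prog.size]; omega, ?_⟩
      simp only [eval, if_neg hle]
      exact .ite_false hle h
  | query v w P Q ihP ihQ =>
    by_cases hle : O (σ.arr v) (σ.arr w)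
    · obtain ⟨c, hc, h⟩ := ihP hP.1 σ
      refine ⟨c + 1, by simp only [Prog.size]; omega, ?_⟩
      simp only [eval, if_pos hle]
      exact .query_true hle h
    · obtain ⟨c, hc, h⟩ := ihQ hP.2 σ
      refine ⟨c + 1, by simp only [Prog.size]; omega, ?_⟩
      simp only [eval, if_neg hle]
      exact .query_false hle h
  | loop p q P _ => exact hP.elim

/-- A loop with a loop-free body that is executed exactly `n` times, with a loop invariant. -/
theorem exists_exec_loop (O : (ℕ → ℤ) → (ℕ → ℤ) → Prop) {p q n : ℕ} {P : Prog}
    (hP : P.LoopFree) (I : ℕ → State → Prop)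
    (hstep : ∀ i < n, ∀ σ, I i σ → σ.reg p ≤ σ.reg q ∧ I (i + 1) (eval O P σ))
    (hend : ∀ σ, I n σ → ¬ σ.reg p ≤ σ.reg q) {σ : State} (hσ : I 0 σ) :
    ∃ σ' c, Exec O (.loop p q P) σ σ' c ∧ c ≤ n * (P.size + 1) + 1 ∧ I n σ' := by
  -- Induction on the number `k` of rounds still to come, from an arbitrary intermediate state.
  suffices H : ∀ k i, i + k = n → ∀ σ, I i σ →
      ∃ σ' c, Exec O (.loop p q P) σ σ' c ∧ c ≤ k * (P.size + 1) + 1 ∧ I n σ' from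
    H n 0 (zero_add n) σ hσ
  intro k
  induction k with
  | zero =>
    rintro i rfl σ hσ
    exact ⟨σ, 1, .loop_done (hend σ hσ), by simp, hσ⟩
  | succ k ih =>
    intro i hi σ hσ
    obtain ⟨hle, hI⟩ := hstep i (by omega) σ hσ
    obtain ⟨c, hc, he⟩ := exec_eval O hP σ
    obtain ⟨σ', c', he', hc', hI'⟩ := ih (i + 1) (by omega) _ hI
    exact ⟨σ', c + c' + 1, .loop_step hle he he', by rw [Nat.succ_mul]; omega, hI'⟩

/-- The programs of a list, one after the other. -/
def seqList (L : List Prog) : Prog := L.foldr .seq .skip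

theorem loopFree_seqList {L : List Prog} (h : ∀ P ∈ L, P.LoopFree) : (seqList L).LoopFree := by
  induction L with
  | nil => trivial
  | cons P L ih =>
    exact ⟨h P (List.mem_cons_self ..), ih fun Q hQ => h Q (List.mem_cons_of_mem _ hQ)⟩

/-- An invariant, indexed by the sublist that is still to be executed, holds at the end if it
holds at the beginning. -/
theorem eval_seqList_map {α : Type*} (O : (ℕ → ℤ) → (ℕ → ℤ) → Prop) (P : α → Prog)
    (I : List α → State → Prop)
    (hstep : ∀ a L σ, I (a :: L) σ → I L (eval O (P a) σ)) (L : List α) {σ : State}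
    (hσ : I L σ) : I [] (eval O (seqList (L.map P)) σ) := by
  induction L generalizing σ with
  | nil => exact hσ
  | cons a L ih => exact ih (hstep a L σ hσ)

@[simp] theorem State.setReg_reg (σ : State) (d : ℕ) (z : ℤ) (r : ℕ) :
    (σ.setReg d z).reg r = if r = d then z else σ.reg r := by
  simp [State.setReg, Function.update_apply]

@[simp] theorem State.setReg_arr (σ : State) (d : ℕ) (z : ℤ) : (σ.setReg d z).arr = σ.arr := rfl

@[simp] theorem State.setArr_arr (σ : State) (v : ℕ) (a : ℕ → ℤ) (w : ℕ) :
    (σ.setArr v a).arr w = if w = v then a else σ.arr w := by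
  simp [State.setArr, Function.update_apply]

@[simp] theorem State.setArr_reg (σ : State) (v : ℕ) (a : ℕ → ℤ) : (σ.setArr v a).reg = σ.reg :=
  rfl

@[simp] theorem State.ite_reg (c : Prop) [Decidable c] (σ τ : State) (r : ℕ) :
    (if c then σ else τ).reg r = if c then σ.reg r else τ.reg r := by
  split_ifs <;> rfl

@[simp] theorem State.ite_arr (c : Prop) [Decidable c] (σ τ : State) (v : ℕ) :
    (if c then σ else τ).arr v = if c then σ.arr v else τ.arr v := by
  split_ifs <;> rfl

/-! ### Adding a vector to a block and checking the bounds -/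

/-- Add `d` to the entry of the array `4` at the position in register `6`, clear register `7` if
the result violates the bounds in the arrays `1` and `2`, and move on to the next position. -/
def addEntry (d : ℤ) : Prog :=
  .seq (.load 4 4 6) <| .seq (.const 5 d) <| .seq (.add 4 4 5) <| .seq (.store 4 6 4) <|
  .seq (.load 5 1 6) <| .seq (.ite 5 4 .skip (.const 7 0)) <|
  .seq (.load 5 2 6) <| .seq (.ite 4 5 .skip (.const 7 0)) (.add 6 6 3)

/-- `addEntry` for `d 0, …, d (m - 1)`. -/
def addEntries (d : ℕ → ℤ) : ℕ → Prog
  | 0 => .skip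
  | m + 1 => .seq (addEntries d m) (addEntry (d m))

theorem loopFree_addEntries (d : ℕ → ℤ) (m : ℕ) : (addEntries d m).LoopFree := by
  induction m with
  | zero => trivial
  | succ m ih => exact ⟨ih, by simp [addEntry, Prog.LoopFree]⟩

theorem addBlock_succ (p m : ℕ) (d a : ℕ → ℤ) :
    addBlock p (m + 1) d a =
      Function.update (addBlock p m d a) (p + m) (addBlock p m d a (p + m) + d m) := by
  funext q
  by_cases hq : q = p + m
  · subst hq
    rw [addBlock_add _ _ (Nat.lt_succ_self m), Function.update_self, addBlock_of_ge _ _ le_rfl]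
  · rw [Function.update_of_ne hq]
    simp only [addBlock]
    exact if_congr (by omega) rfl rfl

theorem inBounds_succ_iff {l u : ℕ → ℤ} {p m : ℕ} {d a : ℕ → ℤ} :
    InBounds l u p (m + 1) (addBlock p (m + 1) d a) ↔
      InBounds l u p m (addBlock p m d a) ∧ l (p + m) ≤ addBlock p m d a (p + m) + d m ∧
        addBlock p m d a (p + m) + d m ≤ u (p + m) := by
  rw [addBlock_succ]
  constructor
  · intro h
    refine ⟨fun q h1 h2 => ?_, ?_⟩
    · have := h q h1 (by omega)
      rwa [Function.update_of_ne (by omega)] at this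
    · have := h (p + m) (by omega) (by omega)
      rwa [Function.update_self] at this
  · rintro ⟨h1, h2⟩ q h3 h4
    by_cases hq : q = p + m
    · subst hq
      rwa [Function.update_self]
    · rw [Function.update_of_ne hq]
      exact h1 q h3 (by omega)

open Classical in
-- Registers 4 to 7 and array 4 are scratch memory; the first two clauses say that nothing else
-- changes.
theorem eval_addEntries (O : (ℕ → ℤ) → (ℕ → ℤ) → Prop) (d : ℕ → ℤ) (m : ℕ) {σ : State} {p : ℕ}
    (h3 : σ.reg 3 = 1) (h6 : σ.reg 6 = p) (h7 : σ.reg 7 = 1) :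
    (∀ r, r ≠ 4 → r ≠ 5 → r ≠ 6 → r ≠ 7 → (eval O (addEntries d m) σ).reg r = σ.reg r) ∧
    (∀ v, v ≠ 4 → (eval O (addEntries d m) σ).arr v = σ.arr v) ∧
    (eval O (addEntries d m) σ).reg 6 = (p + m : ℕ) ∧
    (eval O (addEntries d m) σ).arr 4 = addBlock p m d (σ.arr 4) ∧
    (eval O (addEntries d m) σ).reg 7 =
      if InBounds (σ.arr 1) (σ.arr 2) p m (addBlock p m d (σ.arr 4)) then 1 else 0 := by
  induction m with
  | zero =>
    have h0 : addBlock p 0 d (σ.arr 4) = σ.arr 4 := by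
      funext q
      exact if_neg (by omega)
    have hb : InBounds (σ.arr 1) (σ.arr 2) p 0 (σ.arr 4) := fun q h1 h2 => by omega
    simp [addEntries, eval, h6, h7, h0, hb]
  | succ m ih =>
    obtain ⟨hr, hv, e6, e4, e7⟩ := ih
    have ev : eval O (addEntries d (m + 1)) σ =
      eval O (addEntry (d m)) (eval O (addEntries d m) σ) := rfl
    rw [ev]
    have k3 := hr 3 (by decide) (by decide) (by decide) (by decide)
    have v1 := hv 1 (by decide)
    have v2 := hv 2 (by decide)
    generalize eval O (addEntries d m) σ = τ at hr hv e6 e4 e7 k3 v1 v2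
    rw [h3] at k3
    have hn : ((p : ℤ) + m).toNat = p + m := by omega
    rw [inBounds_succ_iff, addBlock_succ]
    push_cast at e6
    refine ⟨fun r r4 r5 r6 r7 => ?_, fun v hv4 => ?_, ?_, ?_, ?_⟩
    · rw [← hr r r4 r5 r6 r7]
      simp [addEntry, eval, r4, r5, r6, r7]
    · rw [← hv v hv4]
      simp [addEntry, eval, hv4]
    · simp [addEntry, eval, e6, k3, add_assoc]
    · simp [addEntry, eval, e6, hn, e4]
    · simp only [addEntry, eval]
      by_cases c1 : σ.arr 1 (p + m) ≤ addBlock p m d (σ.arr 4) (p + m) + d m <;>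
      by_cases c2 : addBlock p m d (σ.arr 4) (p + m) + d m ≤ σ.arr 2 (p + m) <;>
      simp [c1, c2, e4, e7, e6, hn, v1, v2]

/-! ### One transition of the dynamic program -/

/-- The flag `e` tells whether `S` is nonempty, and if so, then `a` minimizes `F` over `S`. -/
def IsBest (F : (ℕ → ℤ) → ℝ) (S : Set (ℕ → ℤ)) (e : ℤ) (a : ℕ → ℤ) : Prop :=
  (e = 0 ∧ S = ∅) ∨ (e = 1 ∧ a ∈ S ∧ ∀ y ∈ S, F a ≤ F y)

/-- The bounds on a block see only its entries, so a transition is admissible for all partial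
solutions of a state or for none. -/
theorem inBounds_addBlock_congr {l u a a' d : ℕ → ℤ} {p m : ℕ}
    (h : ∀ q, p ≤ q → q < p + m → a q = a' q) (hb : InBounds l u p m (addBlock p m d a)) :
    InBounds l u p m (addBlock p m d a') := fun q h1 h2 => by
  have := hb q h1 h2
  simp only [addBlock, if_pos (And.intro h1 h2)] at this ⊢
  rwa [← h q h1 h2]

/-- If register `cf` flags the array `ca`, add `d` to its block of length `m` at the position in
register `2`; if the result respects the bounds and improves on the array `na` flagged by
register `nf`, replace `na` by it. -/
def relax (cf nf ca na m : ℕ) (d : ℕ → ℤ) : Prog :=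
  -- Register 3 holds 1, so this tests whether the flag is 1. Below, register 2 is moved to register
  -- 6 by adding 0, as there is no instruction that copies registers.
  .ite 3 cf
    (.seq (.seq (.copy 4 ca) <| .seq (.const 7 1) <| .seq (.const 6 0) <| .add 6 2 6) <|
      .seq (addEntries d m) <|
      .ite 3 7
        (.ite 3 nf (.query 4 na (.copy na 4) .skip) (.seq (.copy na 4) (.const nf 1)))
        .skip)
    .skip

theorem loopFree_relax (cf nf ca na m : ℕ) (d : ℕ → ℤ) : (relax cf nf ca na m d).LoopFree := by
  simp [relax, Prog.LoopFree, loopFree_addEntries]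

/-- It suffices to extend the stored best element of `S`. All elements of `S` agree with `x` on the
block: if the extension of the best one violates the bounds, all extensions do, and otherwise it is
a best extension. -/
theorem eval_relax {n t : ℕ} {f : (Fin n × Fin t → ℝ) → ℝ} (hf : SeparableConvex f)
    {cf nf ca na m p : ℕ} {d x : ℕ → ℤ} {σ : State} {S T : Set (ℕ → ℤ)}
    (hnf : 8 ≤ nf) (hna : 5 ≤ na)
    (h3 : σ.reg 3 = 1) (h2 : σ.reg 2 = p)
    (hSx : ∀ a ∈ S, ∀ q, p ≤ q → q < p + m → a q = x q)
    (hS : IsBest (arrayValue f) S (σ.reg cf) (σ.arr ca))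
    (hT : IsBest (arrayValue f) T (σ.reg nf) (σ.arr na)) :
    let τ := eval (comparisonOracle f) (relax cf nf ca na m d) σ
    (∀ r, r ≠ 4 → r ≠ 5 → r ≠ 6 → r ≠ 7 → r ≠ nf → τ.reg r = σ.reg r) ∧
    (∀ v, v ≠ 4 → v ≠ na → τ.arr v = σ.arr v) ∧
    IsBest (arrayValue f) (T ∪ extensions (σ.arr 1) (σ.arr 2) p m d S) (τ.reg nf) (τ.arr na) := by
  intro τ
  rcases hS with ⟨hc, hS⟩ | ⟨hc, ha, hmin⟩
  · have hτ : τ = σ := by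
      simp [τ, relax, eval, h3, hc]
    rw [hτ, hS]
    have : extensions (σ.arr 1) (σ.arr 2) p m d ∅ = ∅ := by
      simp [extensions]
    rw [this, Set.union_empty]
    exact ⟨fun _ _ _ _ _ _ => rfl, fun _ _ _ => rfl, hT⟩
  · set σ₁ := eval (comparisonOracle f)
      (.seq (.copy 4 ca) <| .seq (.const 7 1) <| .seq (.const 6 0) <| .add 6 2 6) σ with hσ₁
    obtain ⟨hr, hv, -, e4, e7⟩ := eval_addEntries (comparisonOracle f) d m (σ := σ₁) (p := p)
      (by simp [hσ₁, eval, h3]) (by simp [hσ₁, eval, h2]) (by simp [hσ₁, eval])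
    set σ₂ := eval (comparisonOracle f) (addEntries d m) σ₁ with hσ₂
    have hτ : τ = eval (comparisonOracle f) (.ite 3 7
        (.ite 3 nf (.query 4 na (.copy na 4) .skip) (.seq (.copy na 4) (.const nf 1)))
        .skip) σ₂ := by
      have hle : σ.reg 3 ≤ σ.reg cf := by rw [h3, hc]
      exact if_pos hle
    have hr' : ∀ r, r ≠ 4 → r ≠ 5 → r ≠ 6 → r ≠ 7 → σ₂.reg r = σ.reg r := by
      intro r r4 r5 r6 r7
      rw [hr r r4 r5 r6 r7]
      simp [hσ₁, eval, r6, r7]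
    have hv' : ∀ v, v ≠ 4 → σ₂.arr v = σ.arr v := by
      intro v v4
      rw [hv v v4]
      simp [hσ₁, eval, v4]
    have hσ₁4 : σ₁.arr 4 = σ.arr ca := by simp [hσ₁, eval]
    have hσ₁1 : σ₁.arr 1 = σ.arr 1 := by simp [hσ₁, eval]
    have hσ₁2 : σ₁.arr 2 = σ.arr 2 := by simp [hσ₁, eval]
    rw [hσ₁4] at e4
    rw [hσ₁4, hσ₁1, hσ₁2] at e7
    have k3 : σ₂.reg 3 = 1 := by
      rw [hr' 3 (by decide) (by decide) (by decide) (by decide), h3]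
    have knf : σ₂.reg nf = σ.reg nf := hr' nf (by omega) (by omega) (by omega) (by omega)
    have kna : σ₂.arr na = σ.arr na := hv' na (by omega)
    have hagree : ∀ a' ∈ S, ∀ q, p ≤ q → q < p + m → σ.arr ca q = a' q :=
      fun a' ha' q q1 q2 => (hSx _ ha q q1 q2).trans (hSx _ ha' q q1 q2).symm
    clear_value σ₂
    by_cases hb : InBounds (σ.arr 1) (σ.arr 2) p m (addBlock p m d (σ.arr ca))
    · rw [if_pos hb] at e7
      have hmem : addBlock p m d (σ.arr ca) ∈ extensions (σ.arr 1) (σ.arr 2) p m d S :=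
        ⟨_, ha, rfl, hb⟩
      have hbest : ∀ y ∈ extensions (σ.arr 1) (σ.arr 2) p m d S,
          arrayValue f (addBlock p m d (σ.arr ca)) ≤ arrayValue f y := by
        rintro _ ⟨a', ha', rfl, -⟩
        exact arrayValue_addBlock_le hf d (hagree a' ha') (hmin a' ha')
      rw [← e4] at hmem hbest
      rcases hT with ⟨hn0, hT⟩ | ⟨hn1, hTa, hTmin⟩
      · have hτ' : τ = (σ₂.setArr na (σ₂.arr 4)).setReg nf 1 := by
          rw [hτ]
          simp [eval, k3, e7, knf, hn0]
        rw [hτ']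
        refine ⟨fun r r4 r5 r6 r7 rn => ?_, fun v v4 vn => ?_, Or.inr ⟨?_, ?_, ?_⟩⟩
        · simp [rn, hr' r r4 r5 r6 r7]
        · simp [vn, hv' v v4]
        · simp
        · simpa [hT] using hmem
        · simpa [hT] using hbest
      · by_cases hq : arrayValue f (σ₂.arr 4) ≤ arrayValue f (σ₂.arr na)
        · have hτ' : τ = σ₂.setArr na (σ₂.arr 4) := by
            rw [hτ]
            have : comparisonOracle f (σ₂.arr 4) (σ₂.arr na) := hq
            simp [eval, k3, e7, knf, hn1, this]
          rw [hτ']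
          refine ⟨fun r r4 r5 r6 r7 rn => ?_, fun v v4 vn => ?_, Or.inr ⟨?_, ?_, ?_⟩⟩
          · simp [hr' r r4 r5 r6 r7]
          · simp [vn, hv' v v4]
          · simp [knf, hn1]
          · simpa using Or.inr hmem
          · rintro y (hy | hy)
            · simpa using (kna ▸ hq).trans (hTmin y hy)
            · simpa using hbest y hy
        · have hτ' : τ = σ₂ := by
            rw [hτ]
            have : ¬ comparisonOracle f (σ₂.arr 4) (σ₂.arr na) := hq
            simp [eval, k3, e7, knf, hn1, this]
          rw [hτ']
          refine ⟨fun r r4 r5 r6 r7 _ => hr' r r4 r5 r6 r7, fun v v4 _ => hv' v v4,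
            Or.inr ⟨knf.trans hn1, ?_, ?_⟩⟩
          · rw [kna]; exact Or.inl hTa
          · rintro y (hy | hy)
            · rw [kna]; exact hTmin y hy
            · exact (not_le.1 hq).le.trans (hbest y hy)
    · rw [if_neg hb] at e7
      have hτ' : τ = σ₂ := by
        rw [hτ]
        simp [eval, k3, e7]
      have hempty : extensions (σ.arr 1) (σ.arr 2) p m d S = ∅ := by
        refine Set.eq_empty_iff_forall_notMem.2 ?_
        rintro _ ⟨a', ha', rfl, hb'⟩
        exact hb (inBounds_addBlock_congr (fun q q1 q2 => (hagree a' ha' q q1 q2).symm) hb')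
      rw [hτ', hempty, Set.union_empty, knf, kna]
      exact ⟨fun r r4 r5 r6 r7 _ => hr' r r4 r5 r6 r7, fun v v4 _ => hv' v v4, hT⟩

/-! ### One stage of the dynamic program -/

/-- What is common to all states at stage `i`: `n`, `i + 1`, `i * t` and `1` are in the registers
`0` to `3`, and the input vectors are in the arrays `0`, `1`, `2`. -/
structure Frame (n t : ℕ) (l u x : ℕ → ℤ) (i : ℕ) (σ : State) : Prop where
  reg0 : σ.reg 0 = n
  -- Counting from 1 makes the loop test `reg 1 ≤ reg 0` mean `i < n`, which gives exactly `n`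
  -- rounds.
  reg1 : σ.reg 1 = i + 1
  reg2 : σ.reg 2 = (i * t : ℕ)
  reg3 : σ.reg 3 = 1
  arr0 : σ.arr 0 = x
  arr1 : σ.arr 1 = l
  arr2 : σ.arr 2 = u

theorem Frame.congr {n t : ℕ} {l u x : ℕ → ℤ} {i : ℕ} {σ τ : State}
    (h : Frame n t l u x i σ) (hr : ∀ r < 4, τ.reg r = σ.reg r)
    (hv : ∀ v < 3, τ.arr v = σ.arr v) : Frame n t l u x i τ where
  reg0 := by rw [hr 0 (by decide), h.reg0]
  reg1 := by rw [hr 1 (by decide), h.reg1]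
  reg2 := by rw [hr 2 (by decide), h.reg2]
  reg3 := by rw [hr 3 (by decide), h.reg3]
  arr0 := by rw [hv 0 (by decide), h.arr0]
  arr1 := by rw [hv 1 (by decide), h.arr1]
  arr2 := by rw [hv 2 (by decide), h.arr2]

/-- The invariant of the main loop: the registers `8 + 2 * k` and the arrays `6 + 2 * k` hold
optimal partial solutions. -/
structure StageInv {n s t m : ℕ} (A₂ : Matrix (Fin s) (Fin t) ℤ) (z : Fin m → Fin t → ℤ)
    (f : (Fin n × Fin t → ℝ) → ℝ) (l u x : ℕ → ℤ) (i : ℕ) (σ : State) : Prop where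
  frame : Frame n t l u x i σ
  best : ∀ k : Fin m,
    IsBest (arrayValue f) (reach A₂ z l u x i k) (σ.reg (8 + 2 * k)) (σ.arr (6 + 2 * k))

/-- Clear the flags of the next stage. -/
def resetStage (m : ℕ) : Prog :=
  -- Even numbers (registers from 8, arrays from 6) belong to the current stage, odd ones (from 9
  -- and 7) to the next. A flag 0 makes stale array contents harmless.
  seqList ((List.finRange m).map fun k : Fin m => .const (9 + 2 * k) 0)

/-- All transitions between two stages. -/
noncomputable def relaxStage {s t m : ℕ} (A₂ : Matrix (Fin s) (Fin t) ℤ)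
    (z : Fin m → Fin t → ℤ) : Prog :=
  seqList ((Finset.univ.filter fun e : Fin m × Fin m => A₂.mulVec (z e.2 - z e.1) = 0).toList.map
    fun e => relax (8 + 2 * e.1) (9 + 2 * e.2) (6 + 2 * e.1) (7 + 2 * e.2) t
      (extendZero (z e.2 - z e.1)))

/-- Make the next stage the current one. -/
def copyStage (m : ℕ) : Prog :=
  seqList ((List.finRange m).map fun k : Fin m =>
    .seq (.copy (6 + 2 * k) (7 + 2 * k)) <| .seq (.const 4 0) <| .add (8 + 2 * k) (9 + 2 * k) 4)

/-- The body of the main loop. -/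
noncomputable def stage {s t m : ℕ} (A₂ : Matrix (Fin s) (Fin t) ℤ) (z : Fin m → Fin t → ℤ) :
    Prog :=
  .seq (resetStage m) <| .seq (relaxStage A₂ z) <| .seq (copyStage m) <|
    .seq (.const 4 t) <| .seq (.add 2 2 4) <| .add 1 1 3

theorem loopFree_stage {s t m : ℕ} (A₂ : Matrix (Fin s) (Fin t) ℤ) (z : Fin m → Fin t → ℤ) :
    (stage A₂ z).LoopFree := by
  refine ⟨loopFree_seqList fun P hP => ?_, loopFree_seqList fun P hP => ?_,
    loopFree_seqList fun P hP => ?_, trivial, trivial, trivial⟩ <;>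
  obtain ⟨k, -, rfl⟩ := List.mem_map.1 hP
  · trivial
  · exact loopFree_relax ..
  · exact ⟨trivial, trivial, trivial⟩

section

variable {n s t m : ℕ} {A₂ : Matrix (Fin s) (Fin t) ℤ} {z : Fin m → Fin t → ℤ}
  {f : (Fin n × Fin t → ℝ) → ℝ} {l u x : ℕ → ℤ} {i : ℕ} {σ : State}

theorem eval_resetStage (h : StageInv A₂ z f l u x i σ) :
    StageInv A₂ z f l u x i (eval (comparisonOracle f) (resetStage m) σ) ∧
      ∀ k : Fin m, (eval (comparisonOracle f) (resetStage m) σ).reg (9 + 2 * k) = 0 := by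
  have H := eval_seqList_map (comparisonOracle f) (fun k : Fin m => .const (9 + 2 * k) 0)
    (fun L τ => StageInv A₂ z f l u x i τ ∧ ∀ k : Fin m, k ∉ L → τ.reg (9 + 2 * k) = 0) ?_
    (List.finRange m) (σ := σ) ⟨h, by simp⟩
  · exact ⟨H.1, fun k => H.2 k (by simp)⟩
  · rintro k L τ ⟨h1, h2⟩
    refine ⟨⟨h1.frame.congr (fun r hr => ?_) fun v hv => rfl, fun k' => ?_⟩, fun k' hk' => ?_⟩
    · simp only [eval, State.setReg_reg]
      exact if_neg (by omega)
    · have := h1.best k'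
      simp only [eval, State.setReg_reg, State.setReg_arr]
      rwa [if_neg (by omega)]
    · simp only [eval, State.setReg_reg]
      split_ifs with hk
      · rfl
      · refine h2 k' fun hmem => ?_
        rcases List.mem_cons.1 hmem with rfl | h
        · exact hk rfl
        · exact hk' h

theorem eval_relaxStage (hf : SeparableConvex f) (h : StageInv A₂ z f l u x i σ)
    (h0 : ∀ k : Fin m, σ.reg (9 + 2 * k) = 0) :
    Frame n t l u x i (eval (comparisonOracle f) (relaxStage A₂ z) σ) ∧
      ∀ k : Fin m, IsBest (arrayValue f) (reach A₂ z l u x (i + 1) k)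
        ((eval (comparisonOracle f) (relaxStage A₂ z) σ).reg (9 + 2 * k))
        ((eval (comparisonOracle f) (relaxStage A₂ z) σ).arr (7 + 2 * k)) := by
  have H := eval_seqList_map (comparisonOracle f)
    (fun e : Fin m × Fin m => relax (8 + 2 * e.1) (9 + 2 * e.2) (6 + 2 * e.1) (7 + 2 * e.2) t
      (extendZero (z e.2 - z e.1)))
    -- `T` collects the candidates for `k'` already examined; together with those of the transitions
    -- pending in `L` they make up the next `reach`.
    (fun L τ => StageInv A₂ z f l u x i τ ∧ ∀ k' : Fin m, ∃ T,
      IsBest (arrayValue f) T (τ.reg (9 + 2 * k')) (τ.arr (7 + 2 * k')) ∧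
      T ∪ {a | ∃ k, (k, k') ∈ L ∧ a ∈ extensions l u (i * t) t (extendZero (z k' - z k))
        (reach A₂ z l u x i k)} = reach A₂ z l u x (i + 1) k') ?_
    (Finset.univ.filter fun e : Fin m × Fin m => A₂.mulVec (z e.2 - z e.1) = 0).toList
    (σ := σ) ⟨h, fun k' => ⟨∅, Or.inl ⟨h0 k', rfl⟩, ?_⟩⟩
  · refine ⟨H.1.frame, fun k => ?_⟩
    obtain ⟨T, hT, hTe⟩ := H.2 k
    rw [← hTe]
    simpa [relaxStage] using hT
  · rintro ⟨k, k'⟩ L τ ⟨h1, h2⟩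
    obtain ⟨T, hT, hTe⟩ := h2 k'
    obtain ⟨e1, e2, e3⟩ := eval_relax hf (cf := 8 + 2 * k) (nf := 9 + 2 * k') (ca := 6 + 2 * k)
      (na := 7 + 2 * k') (m := t) (p := i * t) (d := extendZero (z k' - z k)) (x := x)
      (by omega) (by omega) h1.frame.reg3 h1.frame.reg2
      (fun a ha q hq _ => eq_of_mem_reach ha hq) (h1.best k) hT
    rw [h1.frame.arr1, h1.frame.arr2] at e3
    refine ⟨⟨h1.frame.congr (fun r hr => ?_) fun v hv => ?_, fun j => ?_⟩, fun j => ?_⟩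
    · exact e1 r (by omega) (by omega) (by omega) (by omega) (by omega)
    · exact e2 v (by omega) (by omega)
    · have := h1.best j
      rwa [← e1 _ (by omega) (by omega) (by omega) (by omega) (by omega),
        ← e2 _ (by omega) (by omega)] at this
    · by_cases hj : j = k'
      · subst hj
        refine ⟨_, e3, ?_⟩
        rw [← hTe, Set.union_assoc]
        congr 1
        ext a
        simp only [Set.mem_union, Set.mem_ofPred_eq, List.mem_cons, Prod.mk.injEq, and_true]
        constructor
        · rintro (ha | ⟨k₁, hk₁, ha⟩)
          · exact ⟨k, Or.inl rfl, ha⟩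
          · exact ⟨k₁, Or.inr hk₁, ha⟩
        · rintro ⟨k₁, rfl | hk₁, ha⟩
          · exact Or.inl ha
          · exact Or.inr ⟨k₁, hk₁, ha⟩
      · have hjv : (j : ℕ) ≠ k' := fun h => hj (Fin.ext h)
        obtain ⟨T', hT', hTe'⟩ := h2 j
        refine ⟨T', ?_, ?_⟩
        · rwa [← e1 _ (by omega) (by omega) (by omega) (by omega) (by omega),
            ← e2 _ (by omega) (by omega)] at hT'
        · rw [← hTe']
          simp [hj]
  · rw [Set.empty_union]
    ext a
    simp [reach]

theorem eval_copyStage (h : Frame n t l u x i σ) {S : Fin m → Set (ℕ → ℤ)}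
    (hS : ∀ k : Fin m,
      IsBest (arrayValue f) (S k) (σ.reg (9 + 2 * k)) (σ.arr (7 + 2 * k))) :
    Frame n t l u x i (eval (comparisonOracle f) (copyStage m) σ) ∧
      ∀ k : Fin m, IsBest (arrayValue f) (S k)
        ((eval (comparisonOracle f) (copyStage m) σ).reg (8 + 2 * k))
        ((eval (comparisonOracle f) (copyStage m) σ).arr (6 + 2 * k)) := by
  have H := eval_seqList_map (comparisonOracle f)
    (fun k : Fin m => .seq (.copy (6 + 2 * k) (7 + 2 * k)) <| .seq (.const 4 0) <|
      .add (8 + 2 * k) (9 + 2 * k) 4)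
    (fun L τ => Frame n t l u x i τ ∧ ∀ k : Fin m,
      IsBest (arrayValue f) (S k) (τ.reg (9 + 2 * k)) (τ.arr (7 + 2 * k)) ∧
      (k ∉ L → IsBest (arrayValue f) (S k) (τ.reg (8 + 2 * k)) (τ.arr (6 + 2 * k)))) ?_
    (List.finRange m) (σ := σ) ⟨h, fun k => ⟨hS k, by simp⟩⟩
  · exact ⟨H.1, fun k => (H.2 k).2 (by simp)⟩
  · rintro k L τ ⟨h1, h2⟩
    have key : ∀ j, 8 ≤ j → j ≠ 8 + 2 * (k : ℕ) → (eval (comparisonOracle f)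
        (.seq (.copy (6 + 2 * k) (7 + 2 * k)) <| .seq (.const 4 0) <|
          .add (8 + 2 * k) (9 + 2 * k) 4) τ).reg j = τ.reg j := fun j hj1 hj2 => by
      simp [eval, hj2, show j ≠ 4 by omega]
    have key' : ∀ v, v ≠ 6 + 2 * (k : ℕ) → (eval (comparisonOracle f)
        (.seq (.copy (6 + 2 * k) (7 + 2 * k)) <| .seq (.const 4 0) <|
          .add (8 + 2 * k) (9 + 2 * k) 4) τ).arr v = τ.arr v := fun v hv => by
      simp [eval, hv]
    refine ⟨h1.congr (fun r hr => ?_) fun v hv => key' v (by omega), fun j => ⟨?_, fun hj => ?_⟩⟩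
    · simp [eval, show r ≠ 4 by omega, show r ≠ 8 + 2 * (k : ℕ) by omega]
    · rw [key _ (by omega) (by omega), key' _ (by omega)]
      exact (h2 j).1
    · by_cases hjk : j = k
      · subst hjk
        have := (h2 j).1
        simpa [eval, show 9 + 2 * (j : ℕ) ≠ 4 by omega] using this
      · have hjv : (j : ℕ) ≠ k := fun h => hjk (Fin.ext h)
        rw [key _ (by omega) (by omega), key' _ (by omega)]
        exact (h2 j).2 (by simp [hjk, hj])

theorem eval_stage (hf : SeparableConvex f) (h : StageInv A₂ z f l u x i σ) :
    StageInv A₂ z f l u x (i + 1) (eval (comparisonOracle f) (stage A₂ z) σ) := by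
  obtain ⟨h1, h1'⟩ := eval_resetStage h
  obtain ⟨h2, h2'⟩ := eval_relaxStage hf h1 h1'
  obtain ⟨h3, h3'⟩ := eval_copyStage h2 h2'
  simp only [stage, eval]
  set τ := eval (comparisonOracle f) (copyStage m) (eval (comparisonOracle f) (relaxStage A₂ z)
    (eval (comparisonOracle f) (resetStage m) σ))
  refine ⟨⟨?_, ?_, ?_, ?_, ?_, ?_, ?_⟩, fun k => ?_⟩
  · simp [h3.reg0]
  · simp [h3.reg1, h3.reg3]
  · simp [h3.reg2, Nat.succ_mul]
  · simp [h3.reg3]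
  · simp [h3.arr0]
  · simp [h3.arr1]
  · simp [h3.arr2]
  · have := h3' k
    simpa [show 8 + 2 * (k : ℕ) ≠ 1 by omega, show 8 + 2 * (k : ℕ) ≠ 2 by omega,
      show 8 + 2 * (k : ℕ) ≠ 4 by omega] using this

end

/-! ### Initialization, selection of the best solution, and output -/

/-- Set up the counter and the constant `1`, and store the given point as the only partial
solution of the first stage. -/
noncomputable def initStage {t m : ℕ} (z : Fin m → Fin t → ℤ) : Prog :=
  .seq (.seq (.const 3 1) (.const 1 1)) <|
    seqList ((Finset.univ.filter fun k : Fin m => z k = 0).toList.map fun k : Fin m =>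
      .seq (.copy (6 + 2 * k) 0) (.const (8 + 2 * k) 1))

/-- Select in the array `5` the best among the given point and the solutions found. -/
noncomputable def selectBest {r t m : ℕ} (A₁ : Matrix (Fin r) (Fin t) ℤ)
    (z : Fin m → Fin t → ℤ) : Prog :=
  .seq (.copy 5 0) <|
    seqList ((Finset.univ.filter fun k : Fin m => A₁.mulVec (z k) = 0).toList.map
      fun k : Fin m => .ite 3 (8 + 2 * k) (.query 5 (6 + 2 * k) .skip (.copy 5 (6 + 2 * k))) .skip)

/-- Replace `m` entries of the array `0`, from the position in register `2` on, by their
differences to those of the array `5`. -/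
def subEntries : ℕ → Prog
  | 0 => .skip
  | m + 1 => .seq (subEntries m) <| .seq (.load 4 5 2) <| .seq (.load 5 0 2) <|
      .seq (.sub 4 4 5) <| .seq (.store 0 2 4) <| .add 2 2 3

/-- The body of the loop that computes the output. -/
def subBrick (t : ℕ) : Prog := .seq (subEntries t) (.add 1 1 3)

theorem loopFree_initStage {t m : ℕ} (z : Fin m → Fin t → ℤ) : (initStage z).LoopFree := by
  refine ⟨⟨trivial, trivial⟩, loopFree_seqList fun P hP => ?_⟩
  obtain ⟨k, -, rfl⟩ := List.mem_map.1 hP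
  exact ⟨trivial, trivial⟩

theorem loopFree_selectBest {r t m : ℕ} (A₁ : Matrix (Fin r) (Fin t) ℤ)
    (z : Fin m → Fin t → ℤ) : (selectBest A₁ z).LoopFree := by
  refine ⟨trivial, loopFree_seqList fun P hP => ?_⟩
  obtain ⟨k, -, rfl⟩ := List.mem_map.1 hP
  exact ⟨⟨trivial, trivial⟩, trivial⟩

theorem loopFree_subBrick (t : ℕ) : (subBrick t).LoopFree := by
  refine ⟨?_, trivial⟩
  induction t with
  | zero => trivial
  | succ t ih => exact ⟨ih, trivial, trivial, trivial, trivial, trivial⟩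

/-- States other than zero need no initialization: the registers of the input are zero, so their
flags are already cleared. -/
theorem eval_initStage {n s t m : ℕ} (A₂ : Matrix (Fin s) (Fin t) ℤ) (z : Fin m → Fin t → ℤ)
    (f : (Fin n × Fin t → ℝ) → ℝ) {l u x : ℕ → ℤ} {σ : State} (h0 : σ.reg 0 = n)
    (hr : ∀ r, r ≠ 0 → σ.reg r = 0) (hx : σ.arr 0 = x) (hl : σ.arr 1 = l) (hu : σ.arr 2 = u) :
    StageInv A₂ z f l u x 0 (eval (comparisonOracle f) (initStage z) σ) := by
  have H := eval_seqList_map (comparisonOracle f)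
    (fun k : Fin m => .seq (.copy (6 + 2 * k) 0) (.const (8 + 2 * k) 1))
    (fun L τ => (∀ k ∈ L, z k = 0) ∧ Frame n t l u x 0 τ ∧ ∀ k : Fin m, k ∉ L →
      IsBest (arrayValue f) (reach A₂ z l u x 0 k) (τ.reg (8 + 2 * k)) (τ.arr (6 + 2 * k))) ?_
    (Finset.univ.filter fun k : Fin m => z k = 0).toList
    (σ := eval (comparisonOracle f) (.seq (.const 3 1) (.const 1 1)) σ) ⟨?_, ?_, ?_⟩
  · exact ⟨H.2.1, fun k => H.2.2 k (by simp)⟩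
  · rintro k L τ ⟨h1, h2, h3⟩
    refine ⟨fun j hj => h1 j (List.mem_cons_of_mem _ hj),
      h2.congr (fun r hr => ?_) (fun v hv => ?_), fun j hj => ?_⟩
    · simp only [eval, State.setReg_reg, State.setArr_reg]
      exact if_neg (by omega)
    · simp only [eval, State.setReg_arr, State.setArr_arr]
      exact if_neg (by omega)
    · by_cases hjk : j = k
      · subst hjk
        refine Or.inr ⟨by simp [eval], ?_, ?_⟩
        · simp [eval, h2.arr0, reach, h1 j (List.mem_cons_self ..)]
        · rintro y ⟨rfl, -⟩
          simp [eval, h2.arr0]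
      · have hjv : (j : ℕ) ≠ k := fun h => hjk (Fin.ext h)
        have := h3 j (by simp [hjk, hj])
        simpa [eval, hjv] using this
  · simp
  · refine ⟨?_, ?_, ?_, ?_, ?_, ?_, ?_⟩ <;> simp [eval, h0, hr, hx, hl, hu]
  · intro k hk
    refine Or.inl ⟨?_, ?_⟩
    · simp [eval, hr, show 8 + 2 * (k : ℕ) ≠ 1 by omega, show 8 + 2 * (k : ℕ) ≠ 3 by omega]
    · have : z k ≠ 0 := by simpa using hk
      simp [reach, this]

/-- Starting the competition with `x` ensures that array 5 holds a legitimate candidate even when no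
flag is set. -/
theorem eval_selectBest {n r s t m : ℕ} (A₁ : Matrix (Fin r) (Fin t) ℤ)
    {A₂ : Matrix (Fin s) (Fin t) ℤ} {z : Fin m → Fin t → ℤ} {f : (Fin n × Fin t → ℝ) → ℝ}
    {l u x : ℕ → ℤ} {i : ℕ} {σ : State} (h : StageInv A₂ z f l u x i σ) :
    let τ := eval (comparisonOracle f) (selectBest A₁ z) σ
    Frame n t l u x i τ ∧
      τ.arr 5 ∈ insert x {a | ∃ k, A₁.mulVec (z k) = 0 ∧ a ∈ reach A₂ z l u x i k} ∧
      ∀ y ∈ insert x {a | ∃ k, A₁.mulVec (z k) = 0 ∧ a ∈ reach A₂ z l u x i k},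
        arrayValue f (τ.arr 5) ≤ arrayValue f y := by
  intro τ
  have H := eval_seqList_map (comparisonOracle f)
    (fun k : Fin m => .ite 3 (8 + 2 * k) (.query 5 (6 + 2 * k) .skip (.copy 5 (6 + 2 * k))) .skip)
    (fun L τ => StageInv A₂ z f l u x i τ ∧ ∃ T : Set (ℕ → ℤ), τ.arr 5 ∈ T ∧
      (∀ y ∈ T, arrayValue f (τ.arr 5) ≤ arrayValue f y) ∧
      T ∪ {a | ∃ k ∈ L, a ∈ reach A₂ z l u x i k} =
        insert x {a | ∃ k, A₁.mulVec (z k) = 0 ∧ a ∈ reach A₂ z l u x i k}) ?_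
    (Finset.univ.filter fun k : Fin m => A₁.mulVec (z k) = 0).toList
    (σ := eval (comparisonOracle f) (.copy 5 0) σ) ⟨⟨?_, fun k => ?_⟩, {x}, ?_, ?_, ?_⟩
  · obtain ⟨h1, T, h2, h3, h4⟩ := H
    rw [← h4]
    simp only [List.not_mem_nil, false_and, exists_false, Set.ofPred_false, Set.union_empty]
    exact ⟨h1.frame, h2, h3⟩
  · rintro k L τ ⟨h1, T, h2, h3, h4⟩
    have hunion : (T ∪ reach A₂ z l u x i k) ∪ {a | ∃ k ∈ L, a ∈ reach A₂ z l u x i k} =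
        insert x {a | ∃ k, A₁.mulVec (z k) = 0 ∧ a ∈ reach A₂ z l u x i k} := by
      rw [← h4, Set.union_assoc]
      congr 1
      ext a
      simp
    rcases h1.best k with ⟨he, hS⟩ | ⟨he, ha, hmin⟩
    · have hτ : eval (comparisonOracle f) (.ite 3 (8 + 2 * k)
          (.query 5 (6 + 2 * k) .skip (.copy 5 (6 + 2 * k))) .skip) τ = τ := by
        simp [eval, h1.frame.reg3, he]
      rw [hτ]
      rw [hS, Set.union_empty] at hunion
      exact ⟨h1, T, h2, h3, hunion⟩
    · by_cases hq : arrayValue f (τ.arr 5) ≤ arrayValue f (τ.arr (6 + 2 * k))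
      · have hτ : eval (comparisonOracle f) (.ite 3 (8 + 2 * k)
            (.query 5 (6 + 2 * k) .skip (.copy 5 (6 + 2 * k))) .skip) τ = τ := by
          have : comparisonOracle f (τ.arr 5) (τ.arr (6 + 2 * k)) := hq
          simp [eval, this]
        rw [hτ]
        refine ⟨h1, _, Or.inl h2, ?_, hunion⟩
        rintro y (hy | hy)
        · exact h3 y hy
        · exact hq.trans (hmin y hy)
      · have hτ : eval (comparisonOracle f) (.ite 3 (8 + 2 * k)
            (.query 5 (6 + 2 * k) .skip (.copy 5 (6 + 2 * k))) .skip) τ =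
            τ.setArr 5 (τ.arr (6 + 2 * k)) := by
          have : ¬ comparisonOracle f (τ.arr 5) (τ.arr (6 + 2 * k)) := hq
          simp [eval, h1.frame.reg3, he, this]
        rw [hτ]
        refine ⟨⟨h1.frame.congr (fun r hr => rfl) (fun v hv => ?_), fun j => ?_⟩, _, ?_, ?_,
          hunion⟩
        · rw [State.setArr_arr, if_neg (by omega)]
        · rw [State.setArr_arr, if_neg (by omega)]
          exact h1.best j
        · simpa using Or.inr ha
        · rintro y (hy | hy)
          · simpa using (not_le.1 hq).le.trans (h3 y hy)
          · simpa using hmin y hy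
  · refine h.frame.congr (fun r hr => rfl) (fun v hv => ?_)
    simp only [eval, State.setArr_arr]
    exact if_neg (by omega)
  · have := h.best k
    simp only [eval, State.setArr_arr, State.setArr_reg]
    rwa [if_neg (by omega)]
  · simp [eval, h.frame.arr0]
  · simp [eval, h.frame.arr0]
  · ext a
    simp

theorem eval_subEntries (O : (ℕ → ℤ) → (ℕ → ℤ) → Prop) (m : ℕ) {σ : State} {p : ℕ}
    (h3 : σ.reg 3 = 1) (h2 : σ.reg 2 = p) :
    (∀ r, r ≠ 2 → r ≠ 4 → r ≠ 5 → (eval O (subEntries m) σ).reg r = σ.reg r) ∧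
    (∀ v, v ≠ 0 → (eval O (subEntries m) σ).arr v = σ.arr v) ∧
    (eval O (subEntries m) σ).reg 2 = (p + m : ℕ) ∧
    (eval O (subEntries m) σ).arr 0 =
      fun q => if p ≤ q ∧ q < p + m then σ.arr 5 q - σ.arr 0 q else σ.arr 0 q := by
  induction m with
  | zero =>
    refine ⟨fun _ _ _ _ => rfl, fun _ _ => rfl, h2, ?_⟩
    funext q
    rw [if_neg (by omega)]
    rfl
  | succ m ih =>
    obtain ⟨hr, hv, e2, e0⟩ := ih
    have k3 := hr 3 (by decide) (by decide) (by decide)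
    have v5 := hv 5 (by decide)
    rw [h3] at k3
    have hn : ((p : ℤ) + m).toNat = p + m := by omega
    push_cast at e2
    refine ⟨fun r r2 r4 r5 => ?_, fun v v0 => ?_, ?_, ?_⟩
    · rw [← hr r r2 r4 r5]
      simp [subEntries, eval, r2, r4, r5]
    · rw [← hv v v0]
      simp [subEntries, eval, v0]
    · simp [subEntries, eval, e2, k3, add_assoc]
    · have key : (eval O (subEntries (m + 1)) σ).arr 0 =
          Function.update ((eval O (subEntries m) σ).arr 0) (p + m)
            (σ.arr 5 (p + m) - (eval O (subEntries m) σ).arr 0 (p + m)) := by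
        simp [subEntries, eval, e2, hn, v5]
      rw [key, e0]
      funext q
      by_cases hq : q = p + m
      · subst hq
        simp
      · rw [Function.update_of_ne hq]
        exact if_congr (by omega) rfl rfl

/-- The invariant of the loop that computes the output: the entries of the first `i` bricks of
the array `0` have been replaced. -/
structure SubInv (n t : ℕ) (a x : ℕ → ℤ) (i : ℕ) (σ : State) : Prop where
  reg0 : σ.reg 0 = n
  reg1 : σ.reg 1 = i + 1
  reg2 : σ.reg 2 = (i * t : ℕ)
  reg3 : σ.reg 3 = 1
  arr5 : σ.arr 5 = a
  arr0 : σ.arr 0 = fun q => if q < i * t then a q - x q else x q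

theorem SubInv.eval_subBrick (O : (ℕ → ℤ) → (ℕ → ℤ) → Prop) {n t i : ℕ} {a x : ℕ → ℤ} {σ : State}
    (h : SubInv n t a x i σ) : SubInv n t a x (i + 1) (eval O (subBrick t) σ) := by
  obtain ⟨hr, hv, e2, e0⟩ := eval_subEntries O t h.reg3 h.reg2
  have k0 := hr 0 (by decide) (by decide) (by decide)
  have k1 := hr 1 (by decide) (by decide) (by decide)
  have k3 := hr 3 (by decide) (by decide) (by decide)
  have v5 := hv 5 (by decide)
  refine ⟨?_, ?_, ?_, ?_, ?_, ?_⟩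
  · simp [subBrick, eval, k0, h.reg0]
  · simp [subBrick, eval, k1, k3, h.reg1, h.reg3]
  · simp [subBrick, eval, e2, Nat.succ_mul]
  · simp [subBrick, eval, k3, h.reg3]
  · simp [subBrick, eval, v5, h.arr5]
  · simp only [subBrick, eval, State.setReg_arr, e0, h.arr5, h.arr0, Nat.succ_mul]
    funext q
    by_cases h1 : q < i * t
    · rw [if_neg (by omega), if_pos h1, if_pos (by omega)]
    · by_cases h2 : q < i * t + t
      · rw [if_pos (by omega), if_neg h1, if_pos h2]
      · rw [if_neg (by omega), if_neg h1, if_neg h2]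

/-! ### The whole program -/

/-- The loop that computes the output. -/
def subLoop (t : ℕ) : Prog :=
  -- Register 0 is the loop bound `n`, so it becomes the success flag only after the loop.
  .seq (.seq (.const 1 1) (.const 2 0)) <| .seq (.loop 1 0 (subBrick t)) (.const 0 1)

/-- The program that finds a step at least as good as every feasible Graver step, if the partial
sums of the bricks of the Graver basis elements are all among the vectors `z k`. -/
noncomputable def graverStepProg {r s t m : ℕ} (A₁ : Matrix (Fin r) (Fin t) ℤ)
    (A₂ : Matrix (Fin s) (Fin t) ℤ) (z : Fin m → Fin t → ℤ) : Prog :=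
  .seq (initStage z) <| .seq (.loop 1 0 (stage A₂ z)) <| .seq (selectBest A₁ z) <|
    .query 0 5 (.const 0 0) (subLoop t)

theorem exists_exec_subLoop (O : (ℕ → ℤ) → (ℕ → ℤ) → Prop) {n t : ℕ} {l u x : ℕ → ℤ}
    {σ : State} (h : Frame n t l u x n σ) :
    ∃ σ' c, Exec O (subLoop t) σ σ' c ∧ c ≤ n * ((subBrick t).size + 1) + 4 ∧ σ'.reg 0 = 1 ∧
      ∀ q < n * t, σ'.arr 0 q = σ.arr 5 q - x q := by
  have hinit : SubInv n t (σ.arr 5) x 0 ((σ.setReg 1 1).setReg 2 0) := by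
    refine ⟨?_, ?_, ?_, ?_, ?_, ?_⟩ <;> simp [h.reg0, h.reg3, h.arr0]
  obtain ⟨τ, c, he, hc, hI⟩ := exists_exec_loop O (p := 1) (q := 0) (n := n)
    (loopFree_subBrick t) (SubInv n t (σ.arr 5) x)
    (fun i hi τ hτ => ⟨by rw [hτ.reg0, hτ.reg1]; exact_mod_cast hi, hτ.eval_subBrick O⟩)
    (fun τ hτ => by rw [hτ.reg0, hτ.reg1]; omega) hinit
  refine ⟨τ.setReg 0 1, _, .seq (.seq (.const _ _ _) (.const _ _ _)) (.seq he (.const _ _ _)),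
    by omega, by simp, fun q hq => ?_⟩
  rw [State.setReg_arr, hI.arr0]
  exact if_pos hq

theorem exists_exec_graverStepProg {n r s t m : ℕ} (A₁ : Matrix (Fin r) (Fin t) ℤ)
    (A₂ : Matrix (Fin s) (Fin t) ℤ) (z : Fin m → Fin t → ℤ) {f : (Fin n × Fin t → ℝ) → ℝ}
    (hf : SeparableConvex f) {l u x : ℕ → ℤ} {σ : State} (h0 : σ.reg 0 = n)
    (hr : ∀ r, r ≠ 0 → σ.reg r = 0) (hx : σ.arr 0 = x) (hl : σ.arr 1 = l) (hu : σ.arr 2 = u) :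
    ∃ σ' c, Exec (comparisonOracle f) (graverStepProg A₁ A₂ z) σ σ' c ∧
      c ≤ ((initStage z).size + (stage A₂ z).size + (selectBest A₁ z).size + (subBrick t).size + 8) *
        (n + 1) ∧
      ∃ a ∈ insert x {a | ∃ k, A₁.mulVec (z k) = 0 ∧ a ∈ reach A₂ z l u x n k},
        (∀ y ∈ insert x {a | ∃ k, A₁.mulVec (z k) = 0 ∧ a ∈ reach A₂ z l u x n k},
          arrayValue f a ≤ arrayValue f y) ∧
        ((arrayValue f x ≤ arrayValue f a ∧ σ'.reg 0 = 0) ∨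
          (arrayValue f a < arrayValue f x ∧ σ'.reg 0 = 1 ∧
            ∀ q < n * t, σ'.arr 0 q = a q - x q)) := by
  obtain ⟨c₁, hc₁, he₁⟩ := exec_eval (comparisonOracle f) (loopFree_initStage z) σ
  obtain ⟨τ, c₂, he₂, hc₂, hI⟩ := exists_exec_loop (comparisonOracle f) (p := 1) (q := 0) (n := n)
    (loopFree_stage A₂ z) (StageInv A₂ z f l u x)
    (fun i hi τ hτ => ⟨by rw [hτ.frame.reg0, hτ.frame.reg1]; exact_mod_cast hi,
      eval_stage hf hτ⟩)
    (fun τ hτ => by rw [hτ.frame.reg0, hτ.frame.reg1]; omega)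
    (eval_initStage A₂ z f h0 hr hx hl hu)
  obtain ⟨c₃, hc₃, he₃⟩ := exec_eval (comparisonOracle f) (loopFree_selectBest A₁ z) τ
  obtain ⟨hfr, hmem, hmin⟩ := eval_selectBest A₁ hI
  set ρ := eval (comparisonOracle f) (selectBest A₁ z) τ
  by_cases hq : arrayValue f x ≤ arrayValue f (ρ.arr 5)
  · have hO : comparisonOracle f (ρ.arr 0) (ρ.arr 5) := by rw [hfr.arr0]; exact hq
    refine ⟨ρ.setReg 0 0, _, .seq he₁ (.seq he₂ (.seq he₃ (.query_true hO (.const _ _ _)))), ?_,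
      _, hmem, hmin, Or.inl ⟨hq, by simp⟩⟩
    -- The hint is the surplus from also multiplying by `n` the sizes of parts not executed once per
    -- brick here.
    nlinarith [Nat.zero_le (n * ((initStage z).size + (selectBest A₁ z).size +
      (subBrick t).size))]
  · have hO : ¬ comparisonOracle f (ρ.arr 0) (ρ.arr 5) := by rw [hfr.arr0]; exact hq
    obtain ⟨σ', c₄, he₄, hc₄, h4, h4'⟩ := exists_exec_subLoop (comparisonOracle f) hfr
    refine ⟨σ', _, .seq he₁ (.seq he₂ (.seq he₃ (.query_false hO he₄))), ?_,
      _, hmem, hmin, Or.inr ⟨not_le.1 hq, h4, h4'⟩⟩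
    nlinarith [Nat.zero_le (n * ((initStage z).size + (selectBest A₁ z).size))]

end NFold

/-! ### Choice of the states and conclusion -/

open NFold in
theorem mainTheorem3 (r s t : ℕ) (A₁ : Matrix (Fin r) (Fin t) ℤ) (A₂ : Matrix (Fin s) (Fin t) ℤ) :
    ∃ (P : NFold.Prog) (C : ℕ),
      ∀ (n : ℕ) (b : Fin r ⊕ Fin n × Fin s → ℤ) (l u x : Fin n × Fin t → ℤ)
        (f : (Fin n × Fin t → ℝ) → ℝ),
        NFold.SeparableConvex f →
        x ∈ NFold.feasibleSet (NFold.nFoldProduct n A₁ A₂) b l u →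
        ∃ (σ : NFold.State) (c : ℕ),
          NFold.Exec (NFold.comparisonOracle f) P (NFold.inputState b l u x) σ c ∧
          c ≤ C * (n + 1) ∧
          match NFold.output n t σ with
          | none =>
              ∀ y ∈ NFold.feasibleSet (NFold.nFoldProduct n A₁ A₂) b l u,
                f (NFold.toReal x) ≤ f (NFold.toReal y)
          | some g =>
              x + g ∈ NFold.feasibleSet (NFold.nFoldProduct n A₁ A₂) b l u ∧
              f (NFold.toReal (x + g)) < f (NFold.toReal x) ∧
              ∀ h ∈ NFold.graverBasis (NFold.nFoldProduct n A₁ A₂),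
                x + h ∈ NFold.feasibleSet (NFold.nFoldProduct n A₁ A₂) b l u →
                f (NFold.toReal (x + g)) ≤ f (NFold.toReal (x + h)) := by
  obtain ⟨B, hB⟩ := exists_graver_prefix_bound A₁ A₂
  -- The states are all integer points of the box, so program and constant depend on the bimatrix
  -- alone.
  let Z : Finset (Fin t → ℤ) := Fintype.piFinset fun _ => Finset.Icc (-(B : ℤ)) B
  let z : Fin Z.card → Fin t → ℤ := fun k => (Z.equivFin.symm k).1
  have hz : ∀ v : Fin t → ℤ, (∀ j, |v j| ≤ B) → ∃ k, z k = v := fun v hv => by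
    have hmem : v ∈ Z := Fintype.mem_piFinset.2 fun j => Finset.mem_Icc.2 (abs_le.1 (hv j))
    exact ⟨Z.equivFin ⟨v, hmem⟩, by simp [z]⟩
  refine ⟨graverStepProg A₁ A₂ z, (initStage z).size + (stage A₂ z).size + (selectBest A₁ z).size +
    (subBrick t).size + 8, fun n b l u x f hf hx => ?_⟩
  obtain ⟨σ, c, he, hc, a, ha, hmin, hout⟩ := exists_exec_graverStepProg A₁ A₂ z hf
    (l := toArray l) (u := toArray u) (x := toArray x) (σ := inputState b l u x)
    (by simp [inputState]) (fun r hr => by simp [inputState, hr]) rfl rfl rfl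
  refine ⟨σ, c, he, hc, ?_⟩
  have hval : ∀ v : Fin n × Fin t → ℤ, arrayValue f (toArray v) = f (toReal v) := fun v => by
    rw [arrayValue, readBricks_toArray]
  have hgraver : ∀ h ∈ graverBasis (nFoldProduct n A₁ A₂),
      x + h ∈ feasibleSet (nFoldProduct n A₁ A₂) b l u →
      arrayValue f a ≤ f (toReal (x + h)) := fun h hh hxh => by
    rw [← hval]
    refine hmin _ (Or.inr (exists_toArray_mem_reach hh.1.1 hxh fun I => hz _ fun j => ?_))
    have := hB n h hh I j
    simpa [brick] using this
  rcases hout with ⟨hle, h0⟩ | ⟨hlt, h1, hsub⟩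
  · rw [output, if_pos h0]
    rw [hval] at hle
    -- If `x` is no worse than the best candidate, it is no worse than any feasible Graver step.
    exact optimal_of_graver_steps _ b l u x f hf hx fun g hg hxg => hle.trans (hgraver g hg hxg)
  · rw [output, if_neg (by rw [h1]; decide)]
    rw [hval] at hlt
    have hg : x + readBricks n t (σ.arr 0) = readBricks n t a := by
      funext ⟨i, j⟩
      have := hsub (i * t + j) (block_index_lt i.2 j)
      rw [toArray_index] at this
      simp only [Pi.add_apply, readBricks, this]
      ring
    have hfeas : readBricks n t a ∈ feasibleSet (nFoldProduct n A₁ A₂) b l u := by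
      rcases ha with rfl | ⟨k, hk, hka⟩
      · rwa [readBricks_toArray]
      · exact readBricks_mem_feasibleSet hx hk hka
    simp only [hg]
    exact ⟨hfeas, hlt, hgraver⟩
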